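/- Let $\pi: Y\to X$ be a fibered manifold (a smooth surjective submersion) with $\dim X=n$, $\dim Y=n+m$, and let $\lambda$ be a smooth Lagrangian of arbitrary order $r$, i.e. a fibered morphism $J^r\pi\to\Lambda^nT^*X$ over $X$. In fibered coordinates $(x^i,y^\sigma)$, with jet coordinates $y^\sigma_J$ ($J$ running over symmetric multi-indices), total derivatives $d_i=\partial/\partial x^i+\sum_{\sigma,J} y^\sigma_{Ji}\,\partial/\partial y^\sigma_J$, $ds=dx^1\wedge\dots\wedge dx^n$ and $\omega^\sigma=dy^\sigma-y^\sigma_i\,dx^i$, the Euler–Lagrange form of a horizontal form $\mu=L\,ds$ of order $k$ is $$E_n(\mu)=E_\sigma(\mu)\,\omega^\sigma\wedge ds,\qquad E_\sigma(\mu)=\sum_{|J|=0}^{k}(-1)^{|J|}d_J\frac{\partial L}{\partial y^\sigma_J}.$$ For a smooth vertical vector field $\Xi$ on $Y$, let $\mathcal J_\Xi(\lambda)=E_n(\Xi\rfloor E_n(\lambda))$ be the Jacobi morphism, where $\Xi\rfloor E_n(\lambda)=\Xi^\rho E_\rho(\lambda)\,ds$. Let $\gamma$ be a critical section of $\lambda$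 over an open set of $X$: $\int L_{J^r\Xi}\lambda\circ j^r\gamma=0$ for all vertical fields $\Xi$ with compact support along $\gamma$ (it is enough to require this for supports lying in fibered coordinate domains). Then, in every fibered chart, at the points of the jet prolongation of $\gamma$: 1. for every vertical vector field $\Xi$, $$E_n(\Xi\rfloor E_n(\lambda))=\sum_{|J|=0}^{2r+1}(-1)^{|J|}d_J\Bigl(\Xi^\rho\frac{\partial E_\rho(\lambda)}{\partial y^\sigma_J}\Bigr)\,\omega^\sigma\wedge ds;$$ 2. for every vertical vector field $\Xi$, $$E_n(\Xi\rfloor E_n(\lambda))=\sum_{|J|=0}^{2r+1}d_J\Xi^\sigma\,\frac{\partial E_\rho(\lambda)}{\partial y^\sigma_J}\,\omega^\rho\wedge ds;$$ 3. the Jacobi morphism is self-adjoint: with $A^J_{\tau\sigma}=\partial E_\sigma(\lambda)/\partial y^\tau_J$ it is the linear differential operator $\nabla:\Xi\mapsto\sum_J A^J_{\tau\sigma}\,d_J\Xi^\tau\,\omega^\sigma\wedge ds$, and $\nabla$ coincides with its adjoint $\nabla^*:\Xi\mapsto\sum_J(-1)^{|J|}d_J(A^J_{\tau\sigma}\Xi^\sigma)\,\omega^\tau\wedge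 ds$; moreover, in the chart coordinates, $\int \Xi_2\rfloor\mathcal J_{\Xi_1}(\lambda)=\int\Xi_1\rfloor\mathcal J_{\Xi_2}(\lambda)$ along $\gamma$ for vertical fields $\Xi_1,\Xi_2$ of which $\Xi_1$ has compact support along $\gamma$ inside the chart domain. -/

import Mathlib

open scoped Manifold ContDiff

noncomputable section

/-! ### Multi-indices and iterated derivations -/

/-- Multi-indices `α : Fin n → ℕ` of length `|α| = ∑ i, α i ≤ k`.  A multi-index `α` stands for the
nondecreasing tuple of base indices in which `i` occurs `α i` times. -/
def multiIdx (n k : ℕ) : Finset (Fin n → ℕ) :=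
  (Finset.Iic fun _ : Fin n => k).filter fun α => ∑ i, α i ≤ k

theorem mem_multiIdx {n k : ℕ} {α : Fin n → ℕ} : α ∈ multiIdx n k ↔ ∑ i, α i ≤ k := by
  simp only [multiIdx, Finset.mem_filter, Finset.mem_Iic, and_iff_right_iff_imp]
  exact fun h i => (Finset.single_le_sum (fun j _ => Nat.zero_le (α j)) (Finset.mem_univ i)).trans h

theorem zero_mem_multiIdx (n k : ℕ) : (0 : Fin n → ℕ) ∈ multiIdx n k := by
  simp [mem_multiIdx]

/-- `D_1^{α 1} ∘ ⋯ ∘ D_n^{α n}` for operators `D_1, …, D_n`. -/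
def iterOp {n : ℕ} {S : Type*} (D : Fin n → S → S) (α : Fin n → ℕ) : S → S :=
  ((List.finRange n).map fun i => (D i)^[α i]).foldr (· ∘ ·) id

/-- The partial derivative `∂f/∂x^i` of a function on `ℝⁿ`. -/
def partialD {n : ℕ} (i : Fin n) (f : (Fin n → ℝ) → ℝ) : (Fin n → ℝ) → ℝ :=
  fun x => fderiv ℝ f x (Pi.single i 1)

/-! ### Jet coordinates and operators on functions of the jet coordinates -/

/-- Coordinates `(x^i, y^σ_α)`, with `α` of arbitrary length.  A function on a jet space of finite
order is regarded, up to pull-back, as a function of these coordinates which depends only on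
finitely many of them.  The same type contains the coordinates of the tangent vectors. -/
abbrev JetPt (n m : ℕ) : Type := (Fin n → ℝ) × (Fin m → (Fin n → ℕ) → ℝ)

/-- Coordinates `(x^i, y^σ_α)`, `|α| ≤ k`, on the jet space of order `k`. -/
abbrev JetCoord (n m k : ℕ) : Type :=
  (Fin n → ℝ) × (Fin m → {α : Fin n → ℕ // α ∈ multiIdx n k} → ℝ)

/-- The projection to the jet coordinates of order `k`. -/
def JetPt.trunc {n m : ℕ} (k : ℕ) (z : JetPt n m) : JetCoord n m k :=
  (z.1, fun σ α => z.2 σ α.1)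

/-- `∂F/∂x^i` for a function of the jet coordinates. -/
def jetPartialX {n m : ℕ} (i : Fin n) (F : JetPt n m → ℝ) : JetPt n m → ℝ :=
  fun z => deriv (fun t => F (Function.update z.1 i t, z.2)) (z.1 i)

/-- `∂F/∂y^σ_α` for a function of the jet coordinates. -/
def jetPartialY {n m : ℕ} (σ : Fin m) (α : Fin n → ℕ) (F : JetPt n m → ℝ) : JetPt n m → ℝ :=
  fun z => deriv (fun t => F (z.1, Function.update z.2 σ (Function.update (z.2 σ) α t))) (z.2 σ α)

/-- The total derivative `d_i F = ∂F/∂x^i + ∑ y^σ_{αi} ∂F/∂y^σ_α`.  The sum over `α` is finite,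
since `F` depends on finitely many of the coordinates. -/
def totalD {n m : ℕ} (i : Fin n) (F : JetPt n m → ℝ) : JetPt n m → ℝ :=
  fun z => jetPartialX i F z +
    ∑ σ, ∑ᶠ α : Fin n → ℕ, z.2 σ (α + Pi.single i 1) * jetPartialY σ α F z

/-- The iterated total derivative `d_α`. -/
def totalDs {n m : ℕ} (α : Fin n → ℕ) (F : JetPt n m → ℝ) : JetPt n m → ℝ :=
  iterOp totalD α F

/-! ### Forms in jet coordinates -/

/-- Values at a point of `q`-forms in the jet coordinates. -/
abbrev JetForm (n m q : ℕ) : Type := JetPt n m [⋀^Fin q]→ₗ[ℝ] ℝ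

/-- `ds = dx^1 ∧ ⋯ ∧ dx^n`. -/
def baseVol (n m : ℕ) : JetForm n m n :=
  (Matrix.detRowAlternating (n := Fin n) (R := ℝ)).compLinearMap
    (LinearMap.fst ℝ (Fin n → ℝ) (Fin m → (Fin n → ℕ) → ℝ))

/-- The contact `1`-form `ω^σ = dy^σ - y^σ_i dx^i` at `z`. -/
def contactForm {n m : ℕ} (z : JetPt n m) (σ : Fin m) : JetPt n m →ₗ[ℝ] ℝ where
  toFun v := v.2 σ 0 - ∑ i, z.2 σ (Pi.single i 1) * v.1 i
  map_add' v w := by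
    simp only [Prod.fst_add, Prod.snd_add, Pi.add_apply, mul_add, Finset.sum_add_distrib]; ring
  map_smul' a v := by
    simp only [Prod.smul_fst, Prod.smul_snd, Pi.smul_apply, smul_eq_mul, RingHom.id_apply, mul_sub,
      Finset.mul_sum]
    exact congrArg _ (Finset.sum_congr rfl fun i _ => by ring)

/-- The source form `ω^σ ∧ ds` at `z`. -/
def contactVol {n m : ℕ} (z : JetPt n m) (σ : Fin m) : JetForm n m (n + 1) :=
  AlternatingMap.alternatizeUncurryFin ((contactForm z σ).smulRight (baseVol n m))

/-- The coefficient `F` of a horizontal `n`-form `F ds`: its value on `∂/∂x^1, …, ∂/∂x^n`. -/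
def density {n m : ℕ} (η : JetForm n m n) : ℝ :=
  η fun i => (Pi.single i 1, 0)

/-- The Euler–Lagrange expressions
`E_σ = ∑_{|α| ≤ k} (-1)^{|α|} d_α (∂L/∂y^σ_α)` of a density `L` of order at most `k`. -/
def eulerExpr {n m : ℕ} (k : ℕ) (L : JetPt n m → ℝ) (σ : Fin m) : JetPt n m → ℝ :=
  fun z => ∑ α ∈ multiIdx n k, (-1 : ℝ) ^ (∑ i, α i) * totalDs α (jetPartialY σ α L) z

/-- The Euler–Lagrange form `E_n(η) = E_σ ω^σ ∧ ds` of a horizontal `n`-form `η` of order at most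
`k`. -/
def eulerForm {n m : ℕ} (k : ℕ) (η : JetPt n m → JetForm n m n) :
    JetPt n m → JetForm n m (n + 1) :=
  fun z => ∑ σ, eulerExpr k (fun w => density (η w)) σ z • contactVol z σ

/-! ### Fibered manifolds, sections, vertical vector fields -/

/-- `π : Y → X` is a fibered manifold: a surjective submersion of smooth manifolds, with
`dim X = n` and `dim Y = n + m`. -/
structure IsFibered (n m : ℕ) {X Y : Type*} [TopologicalSpace X] [ChartedSpace (Fin n → ℝ) X]
    [TopologicalSpace Y] [ChartedSpace ((Fin n → ℝ) × (Fin m → ℝ)) Y] (π : Y → X) : Prop where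
  surjective : Function.Surjective π
  smooth : ContMDiff 𝓘(ℝ, (Fin n → ℝ) × (Fin m → ℝ)) 𝓘(ℝ, Fin n → ℝ) ∞ π
  submersion : Manifold.IsSubmersion 𝓘(ℝ, (Fin n → ℝ) × (Fin m → ℝ)) 𝓘(ℝ, Fin n → ℝ) ∞ π

/-- Fibered coordinates `(x^i, y^σ)`: a chart of `Y` adapted to the projection, together with the
chart of `X` over which it lies. -/
structure FiberedChart (n m : ℕ) {X Y : Type*} [TopologicalSpace X] [ChartedSpace (Fin n → ℝ) X]
    [TopologicalSpace Y] [ChartedSpace ((Fin n → ℝ) × (Fin m → ℝ)) Y] (π : Y → X) where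
  base : OpenPartialHomeomorph X (Fin n → ℝ)
  total : OpenPartialHomeomorph Y ((Fin n → ℝ) × (Fin m → ℝ))
  base_mem : base ∈ IsManifold.maximalAtlas 𝓘(ℝ, Fin n → ℝ) ∞ X
  total_mem : total ∈ IsManifold.maximalAtlas 𝓘(ℝ, (Fin n → ℝ) × (Fin m → ℝ)) ∞ Y
  image_source : π '' total.source = base.source
  adapted : ∀ p ∈ total.source, base (π p) = (total p).1

/-- A smooth section of `π` over an open subset of `X` (only the values on `dom` matter). -/
structure LocalSection (n m : ℕ) {X Y : Type*} [TopologicalSpace X] [ChartedSpace (Fin n → ℝ) X]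
    [TopologicalSpace Y] [ChartedSpace ((Fin n → ℝ) × (Fin m → ℝ)) Y] (π : Y → X) where
  dom : TopologicalSpace.Opens X
  toFun : X → Y
  smooth : ContMDiffOn 𝓘(ℝ, Fin n → ℝ) 𝓘(ℝ, (Fin n → ℝ) × (Fin m → ℝ)) ∞ toFun dom
  isSection : ∀ x ∈ dom, π (toFun x) = x

/-- A smooth `π`-vertical vector field on `Y`. -/
structure VerticalField (n m : ℕ) {X Y : Type*} [TopologicalSpace X] [ChartedSpace (Fin n → ℝ) X]
    [TopologicalSpace Y] [ChartedSpace ((Fin n → ℝ) × (Fin m → ℝ)) Y]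
    [IsManifold 𝓘(ℝ, (Fin n → ℝ) × (Fin m → ℝ)) ∞ Y] (π : Y → X) where
  toFun : ∀ p : Y, TangentSpace 𝓘(ℝ, (Fin n → ℝ) × (Fin m → ℝ)) p
  smooth : ContMDiff 𝓘(ℝ, (Fin n → ℝ) × (Fin m → ℝ))
    (𝓘(ℝ, (Fin n → ℝ) × (Fin m → ℝ))).tangent ∞
    (fun p => (⟨p, toFun p⟩ : TangentBundle 𝓘(ℝ, (Fin n → ℝ) × (Fin m → ℝ)) Y))
  vertical : ∀ p,
    mfderiv 𝓘(ℝ, (Fin n → ℝ) × (Fin m → ℝ)) 𝓘(ℝ, Fin n → ℝ) π p (toFun p) = 0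

section

variable {n m : ℕ} {X Y : Type*} [TopologicalSpace X] [ChartedSpace (Fin n → ℝ) X]
  [TopologicalSpace Y] [ChartedSpace ((Fin n → ℝ) × (Fin m → ℝ)) Y] {π : Y → X}

namespace FiberedChart

/-- The coordinates `x^i = ξ^i`, `y^σ_α = ∂^α γ^σ / ∂x^α (ξ)` of the jet of the section `γ` at the
point with base coordinates `ξ`. -/
def jet (c : FiberedChart n m π) (γ : LocalSection n m π) (ξ : Fin n → ℝ) : JetPt n m :=
  (ξ, fun σ α => iterOp partialD α (fun ζ => (c.total (γ.toFun (c.base.symm ζ))).2 σ) ξ)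

/-- The coordinate vectors `∂/∂x^1, …, ∂/∂x^n` at `x`. -/
def frame (c : FiberedChart n m π) (x : X) (i : Fin n) : TangentSpace 𝓘(ℝ, Fin n → ℝ) x :=
  (mfderiv 𝓘(ℝ, Fin n → ℝ) 𝓘(ℝ, Fin n → ℝ) c.base x).inverse (Pi.single i 1)

/-- The points of the domain of `γ` at which `γ` takes values in the chart. -/
def region (c : FiberedChart n m π) (γ : LocalSection n m π) : Set X :=
  {x | x ∈ γ.dom ∧ γ.toFun x ∈ c.total.source}

/-- The base coordinates of the points of the region. -/
def regionCoord (c : FiberedChart n m π) (γ : LocalSection n m π) : Set (Fin n → ℝ) :=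
  c.base '' c.region γ

/-- Jet coordinates of order `k` of the jets with values in the domain of the chart. -/
def jetDomain (c : FiberedChart n m π) (k : ℕ) : Set (JetCoord n m k) :=
  {z | (z.1, fun σ => z.2 σ ⟨0, zero_mem_multiIdx n k⟩) ∈ c.total.target}

end FiberedChart

/-! ### Jet spaces and Lagrangians -/

/-- A local section together with a point of its domain. -/
structure PointedSection (n m : ℕ) {X Y : Type*} [TopologicalSpace X]
    [ChartedSpace (Fin n → ℝ) X] [TopologicalSpace Y]
    [ChartedSpace ((Fin n → ℝ) × (Fin m → ℝ)) Y] (π : Y → X) where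
  sec : LocalSection n m π
  pt : X
  mem : pt ∈ sec.dom

/-- Equality of values and of derivatives up to the order `k`, in all fibered charts. -/
def jetSetoid (n m : ℕ) {X Y : Type*} [TopologicalSpace X]
    [ChartedSpace (Fin n → ℝ) X] [TopologicalSpace Y]
    [ChartedSpace ((Fin n → ℝ) × (Fin m → ℝ)) Y] (π : Y → X) (k : ℕ) : Setoid (PointedSection n m π) where
  r p q := p.pt = q.pt ∧ p.sec.toFun p.pt = q.sec.toFun q.pt ∧
    ∀ c : FiberedChart n m π, p.sec.toFun p.pt ∈ c.total.source →
      (c.jet p.sec (c.base p.pt)).trunc k = (c.jet q.sec (c.base q.pt)).trunc k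
  iseqv :=
    { refl := fun _ => ⟨rfl, rfl, fun _ _ => rfl⟩
      symm := fun h => ⟨h.1.symm, h.2.1.symm, fun c hc => (h.2.2 c (h.2.1 ▸ hc)).symm⟩
      trans := fun h h' => ⟨h.1.trans h'.1, h.2.1.trans h'.2.1, fun c hc =>
        (h.2.2 c hc).trans (h'.2.2 c (h.2.1 ▸ hc))⟩ }

/-- The jet space `J^k π`. -/
def Jet (n m : ℕ) {X Y : Type*} [TopologicalSpace X]
    [ChartedSpace (Fin n → ℝ) X] [TopologicalSpace Y]
    [ChartedSpace ((Fin n → ℝ) × (Fin m → ℝ)) Y] (π : Y → X) (k : ℕ) : Type _ := Quotient (jetSetoid n m π k)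

/-- The jet `j^k_x γ`. -/
def Jet.of {k : ℕ} (p : PointedSection n m π) : Jet n m π k := Quotient.mk (jetSetoid n m π k) p

/-- The projection `J^k π → X`. -/
def Jet.base {k : ℕ} (j : Jet n m π k) : X :=
  Quotient.lift (s := jetSetoid n m π k) PointedSection.pt (fun _ _ h => h.1) j

/-- A Lagrangian of order `r`: a fibered morphism `J^r π → Λ^n T^*X` over the identity of `X`, which
is smooth, i.e. of the form `L(x^i, y^σ_α) ds` with a smooth `L` in every fibered chart. -/
structure Lagrangian (n m : ℕ) {X Y : Type*} [TopologicalSpace X]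
    [ChartedSpace (Fin n → ℝ) X] [TopologicalSpace Y]
    [ChartedSpace ((Fin n → ℝ) × (Fin m → ℝ)) Y] (π : Y → X) (r : ℕ) where
  toFun : ∀ j : Jet n m π r, TangentSpace 𝓘(ℝ, Fin n → ℝ) j.base [⋀^Fin n]→ₗ[ℝ] ℝ
  smooth : ∀ c : FiberedChart n m π, ∃ L : JetCoord n m r → ℝ,
    ContDiffOn ℝ ∞ L (c.jetDomain r) ∧
    ∀ p : PointedSection n m π, p.sec.toFun p.pt ∈ c.total.source →
      toFun (Jet.of p) (c.frame p.pt) = L ((c.jet p.sec (c.base p.pt)).trunc r)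

namespace FiberedChart

/-- The Lagrangian density `L` in the chart `c` as a function of the jet coordinates of order `r`.
Only its values on `c.jetDomain r` matter; these are determined by the Lagrangian, because every
point of `c.jetDomain r` consists of the coordinates of the jet of a local section. -/
def lagDensity (c : FiberedChart n m π) {r : ℕ} (lam : Lagrangian n m π r) : JetCoord n m r → ℝ :=
  (lam.smooth c).choose

/-- The Lagrangian in the chart `c`, as the horizontal form `L ds`. -/
def lagForm (c : FiberedChart n m π) {r : ℕ} (lam : Lagrangian n m π r) (z : JetPt n m) :
    JetForm n m n :=
  c.lagDensity lam (z.trunc r) • baseVol n m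

/-- The Euler–Lagrange expressions `E_σ(λ)` in the chart `c`. -/
def lagEuler (c : FiberedChart n m π) {r : ℕ} (lam : Lagrangian n m π r) (σ : Fin m) : JetPt n m → ℝ :=
  eulerExpr r (fun z => c.lagDensity lam (z.trunc r)) σ

variable [IsManifold 𝓘(ℝ, (Fin n → ℝ) × (Fin m → ℝ)) ∞ Y]

/-- The components `Ξ^σ` of a vertical vector field, as functions of the jet coordinates. -/
def comp (c : FiberedChart n m π) (Ξ : VerticalField n m π) (σ : Fin m) : JetPt n m → ℝ :=
  fun z => (mfderiv 𝓘(ℝ, (Fin n → ℝ) × (Fin m → ℝ)) 𝓘(ℝ, (Fin n → ℝ) × (Fin m → ℝ)) c.total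
    (c.total.symm (z.1, fun τ => z.2 τ 0))
    (Ξ.toFun (c.total.symm (z.1, fun τ => z.2 τ 0)))).2 σ

/-- The prolongation `∑ d_α Ξ^σ ∂/∂y^σ_α` of a vertical vector field (of any order). -/
def prolong (c : FiberedChart n m π) (Ξ : VerticalField n m π) (z : JetPt n m) : JetPt n m :=
  (0, fun σ α => totalDs α (c.comp Ξ σ) z)

/-- The contraction `Ξ ⌋ η` of a form with the prolongation of `Ξ`. -/
def contract (c : FiberedChart n m π) (Ξ : VerticalField n m π) {q : ℕ}
    (η : JetPt n m → JetForm n m (q + 1)) (z : JetPt n m) : JetForm n m q :=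
  (η z).curryLeft (c.prolong Ξ z)

/-- The Jacobi morphism `𝒥_Ξ(λ) = E_n(Ξ ⌋ E_n(λ))` of a Lagrangian `λ` of order `r`; the Lagrangian
`Ξ ⌋ E_n(λ)` has order at most `2r + 1`. -/
def jacobi (c : FiberedChart n m π) {r : ℕ} (lam : Lagrangian n m π r) (Ξ : VerticalField n m π) :
    JetPt n m → JetForm n m (n + 1) :=
  eulerForm (2 * r + 1) (c.contract Ξ (eulerForm r (c.lagForm lam)))

/-- The coefficient of `ds` in the Lie derivative
`L_{J^r Ξ} λ = (∑_{|α| ≤ r} d_α Ξ^σ ∂L/∂y^σ_α) ds`. -/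
def lieDensity (c : FiberedChart n m π) {r : ℕ} (lam : Lagrangian n m π r) (Ξ : VerticalField n m π) :
    JetPt n m → ℝ :=
  fun z => ∑ σ, ∑ α ∈ multiIdx n r,
    totalDs α (c.comp Ξ σ) z * jetPartialY σ α (fun w => c.lagDensity lam (w.trunc r)) z

/-- `Ξ ∘ γ` has compact support, contained in the region of `γ` in the chart. -/
def CompactAlong (c : FiberedChart n m π) (γ : LocalSection n m π) (Ξ : VerticalField n m π) : Prop :=
  ∃ K : Set X, IsCompact K ∧ K ⊆ c.region γ ∧ ∀ x ∈ γ.dom, x ∉ K → Ξ.toFun (γ.toFun x) = 0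

/-- The coefficients `A^α_{τσ} = ∂E_σ(λ)/∂y^τ_α` of the linearized Euler–Lagrange expressions. -/
def jacobiCoeff (c : FiberedChart n m π) {r : ℕ} (lam : Lagrangian n m π r) (α : Fin n → ℕ)
    (τ σ : Fin m) : JetPt n m → ℝ :=
  jetPartialY τ α (c.lagEuler lam σ)

/-- The operator `Ξ ↦ ∑_{|α| ≤ k} A^α_{τσ} d_α Ξ^τ ω^σ ∧ ds` with coefficients `A α τ σ`. -/
def nabla (c : FiberedChart n m π) (k : ℕ) (A : (Fin n → ℕ) → Fin m → Fin m → JetPt n m → ℝ)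
    (Ξ : VerticalField n m π) (z : JetPt n m) : JetForm n m (n + 1) :=
  ∑ σ, (∑ τ, ∑ α ∈ multiIdx n k, A α τ σ z * totalDs α (c.comp Ξ τ) z) • contactVol z σ

/-- The adjoint operator `Ξ ↦ ∑_{|α| ≤ k} (-1)^{|α|} d_α (A^α_{τσ} Ξ^σ) ω^τ ∧ ds`. -/
def nablaStar (c : FiberedChart n m π) (k : ℕ) (A : (Fin n → ℕ) → Fin m → Fin m → JetPt n m → ℝ)
    (Ξ : VerticalField n m π) (z : JetPt n m) : JetForm n m (n + 1) :=
  ∑ τ, (∑ σ, ∑ α ∈ multiIdx n k, (-1 : ℝ) ^ (∑ i, α i) *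
    totalDs α (fun w => A α τ σ w * c.comp Ξ σ w) z) • contactVol z τ

end FiberedChart

variable [IsManifold 𝓘(ℝ, (Fin n → ℝ) × (Fin m → ℝ)) ∞ Y]

/-- `γ` is a critical section (extremal): `∫ L_{J^r Ξ} λ ∘ j^r γ = 0` for every vertical vector
field `Ξ` on `Y` with compact support along `γ`.  By a partition of unity it is enough to consider
the fields whose support along `γ` lies in the domain of some fibered chart. -/
def Lagrangian.IsCritical {r : ℕ} (lam : Lagrangian n m π r) (γ : LocalSection n m π) : Prop :=
  ∀ (c : FiberedChart n m π) (Ξ : VerticalField n m π), c.CompactAlong γ Ξ →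
    ∫ ξ in c.regionCoord γ, c.lieDensity lam Ξ (c.jet γ ξ) = 0

end

end

/-!
The proof works in a fibered chart, along the coordinate expression `ξ ↦ (ξ, s ξ)` of the section.
There total derivatives become partial derivatives in the base coordinates
(`IsSecOn.totalDs_secJet`), and functions of the jet coordinates are handled through their
directional derivatives: both the total derivative `d_i` and the derivative
`D_ψ F = ∑ ∂^α ψ^σ ∂F/∂y^σ_α` in the direction of a variation `ψ` (`linearizeAt`) are derivatives
along one vector field each, and `D_ψ (d_i F) = ∂_i (D_ψ F)` is the symmetry of the second derivative
(`IsSecOn.linearizeAt_totalD`).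

Criticality yields the Euler–Lagrange equations `E_σ ∘ j γ = 0`
(`Lagrangian.IsCritical.lagEuler_jet_eq_zero`): every test function on the base is a component along
`γ` of a vertical field on `Y`, obtained from `∂/∂y^σ` by cutting off in the chart
(`FiberedChart.exists_compactAlong`).  In `E_n(Ξ ⌋ E_n(λ))` the product rule produces terms
`∂Ξ^ρ/∂y^σ E_ρ`, which therefore vanish along `γ`; this is the first coordinate expression
(`FiberedChart.eulerExpr_contract_jet`).

The remaining claims rest on the formal self-adjointness of the linearized Euler–Lagrange
expressions, the Helmholtz conditions, which hold along every section
(`IsSecOn.linearizeAt_eulerExpr_eq_adjoint`).  Since `D_ψ` commutes with the derivatives in `E_σ`,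
integration by parts shows that `∫ φ^σ D_ψ E_σ` is the integral of the second derivative of the
Lagrangian density in the directions of `φ` and `ψ`, hence is symmetric as soon as one of the two has
compact support (`IsSecOn.integral_mul_linearizeAt_eulerExpr_comm`).  Integrating `∫ ψ^σ D_φ E_σ` by
parts once more and applying the fundamental lemma of the calculus of variations to the test
variation `φ` gives the pointwise identity.  The integral symmetry for two vertical fields is the
same symmetry of the second variation.
-/

/-! ### Iterated commuting operators -/

/-- Relations which are respected by each operator are respected by the iterated operators.  The
relation may depend on an order, which increases by one with each application. -/
theorem iterOp_rel {n : ℕ} {S S' : Type*} {D : Fin n → S → S} {D' : Fin n → S' → S'}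
    (R : ℕ → S → S' → Prop) (hR : ∀ k i a b, R k a b → R (k + 1) (D i a) (D' i b))
    (α : Fin n → ℕ) {k : ℕ} {a : S} {b : S'} (h : R k a b) :
    R (k + ∑ i, α i) (iterOp D α a) (iterOp D' α b) := by
  have hpow : ∀ i (N k : ℕ) a b, R k a b → R (k + N) ((D i)^[N] a) ((D' i)^[N] b) := by
    intro i N
    induction N with
    | zero => intro k a b h; exact h
    | succ N ih =>
      intro k a b h
      rw [Function.iterate_succ_apply', Function.iterate_succ_apply', ← add_assoc]
      exact hR _ _ _ _ (ih _ _ _ h)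
  have hlist : ∀ l : List (Fin n), R (k + (l.map α).sum)
      ((l.map fun i => (D i)^[α i]).foldr (· ∘ ·) id a)
      ((l.map fun i => (D' i)^[α i]).foldr (· ∘ ·) id b) := by
    intro l
    induction l with
    | nil => simpa using h
    | cons i l ih =>
      have := hpow i (α i) _ _ _ ih
      simp only [List.map_cons, List.sum_cons, List.foldr_cons, Function.comp_apply]
      rwa [add_comm (α i), ← add_assoc]
  have := hlist (List.finRange n)
  rwa [← Fin.sum_univ_def] at this

/-- The iterated operators `D_1^{α 1} ∘ ⋯ ∘ D_n^{α n}` preserve every property that is preserved by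
each `D_i`. -/
theorem iterOp_induction {n : ℕ} {S : Type*} {D : Fin n → S → S} (P : S → Prop)
    (hP : ∀ i a, P a → P (D i a)) (α : Fin n → ℕ) {a : S} (h : P a) : P (iterOp D α a) :=
  iterOp_rel (D' := D) (fun _ a _ => P a) (fun _ i a _ => hP i a) α (k := 0) (b := a) h

@[simp]
theorem iterOp_zero {n : ℕ} {S : Type*} (D : Fin n → S → S) (a : S) : iterOp D 0 a = a := by
  have : ∀ l : List (Fin n),
      (l.map fun i => (D i)^[(0 : Fin n → ℕ) i]).foldr (· ∘ ·) id a = a := by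
    intro l
    induction l with
    | nil => rfl
    | cons i l ih => simpa using ih
  exact this _

/-- For operators which commute up to a relation `R` on the elements with a property `P`, the
operator of index `α + 1_i` is `D_i` after the operator of index `α`. -/
theorem iterOp_add_single {n : ℕ} {S : Type*} {D : Fin n → S → S} {P : S → Prop}
    {R : S → S → Prop} (hrefl : ∀ a, R a a) (htrans : ∀ a b c, R a b → R b c → R a c)
    (hP : ∀ i a, P a → P (D i a)) (hR : ∀ i a b, R a b → R (D i a) (D i b))
    (hcomm : ∀ i j a, P a → R (D i (D j a)) (D j (D i a)))
    (α : Fin n → ℕ) (i : Fin n) {a : S} (ha : P a) :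
    R (iterOp D (α + Pi.single i 1) a) (D i (iterOp D α a)) := by
  have hpowP : ∀ j (N : ℕ) a, P a → P ((D j)^[N] a) := by
    intro j N
    induction N with
    | zero => intro a h; exact h
    | succ N ih => intro a h; rw [Function.iterate_succ_apply']; exact hP _ _ (ih _ h)
  have hpowR : ∀ j (N : ℕ) a b, R a b → R ((D j)^[N] a) ((D j)^[N] b) := by
    intro j N
    induction N with
    | zero => intro a b h; exact h
    | succ N ih =>
      intro a b h
      rw [Function.iterate_succ_apply', Function.iterate_succ_apply']
      exact hR _ _ _ (ih _ _ h)
  have hpowcomm : ∀ j (N : ℕ) a, P a → R ((D j)^[N] (D i a)) (D i ((D j)^[N] a)) := by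
    intro j N
    induction N with
    | zero => intro a _; exact hrefl _
    | succ N ih =>
      intro a h
      rw [Function.iterate_succ_apply', Function.iterate_succ_apply']
      exact htrans _ _ _ (hR _ _ _ (ih _ h)) (hcomm _ _ _ (hpowP _ _ _ h))
  have hlistP : ∀ l : List (Fin n), P ((l.map fun j => (D j)^[α j]).foldr (· ∘ ·) id a) := by
    intro l
    induction l with
    | nil => exact ha
    | cons j l ih => exact hpowP _ _ _ ih
  have hnot : ∀ l : List (Fin n), i ∉ l →
      (l.map fun j => (D j)^[(α + Pi.single i 1 : Fin n → ℕ) j]).foldr (· ∘ ·) id a =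
        (l.map fun j => (D j)^[α j]).foldr (· ∘ ·) id a := by
    intro l hl
    have : l.map (fun j => (D j)^[(α + Pi.single i 1 : Fin n → ℕ) j]) =
        l.map fun j => (D j)^[α j] := by
      refine List.map_congr_left fun j hj => ?_
      have : j ≠ i := fun h => hl (h ▸ hj)
      simp [this]
    rw [this]
  have hlist : ∀ l : List (Fin n), l.Nodup → i ∈ l →
      R ((l.map fun j => (D j)^[(α + Pi.single i 1 : Fin n → ℕ) j]).foldr (· ∘ ·) id a)
        (D i ((l.map fun j => (D j)^[α j]).foldr (· ∘ ·) id a)) := by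
    intro l
    induction l with
    | nil => intro _ h; simp at h
    | cons j l ih =>
      intro hn hi
      rw [List.nodup_cons] at hn
      simp only [List.map_cons, List.foldr_cons, Function.comp_apply]
      by_cases hij : i = j
      · subst hij
        rw [hnot l hn.1, ← Function.iterate_succ_apply' (D i)]
        simpa using hrefl _
      · have hi' : i ∈ l := (List.mem_cons.1 hi).resolve_left hij
        have hj : (α + Pi.single i 1 : Fin n → ℕ) j = α j := by simp [Ne.symm hij]
        rw [hj]
        exact htrans _ _ _ (hpowR _ _ _ _ (ih hn.2 hi')) (hpowcomm _ _ _ (hlistP l))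
  exact hlist _ (List.nodup_finRange n) (List.mem_finRange i)

/-- Induction on multi-indices, adding one base index at a time. -/
theorem multiIdx_induction {n : ℕ} {P : (Fin n → ℕ) → Prop} (zero : P 0)
    (add_single : ∀ α i, P α → P (α + Pi.single i 1)) (α : Fin n → ℕ) : P α := by
  suffices h : ∀ N, ∀ α : Fin n → ℕ, ∑ i, α i = N → P α from h _ α rfl
  intro N
  induction N with
  | zero =>
    intro α hα
    have : α = 0 := by ext i; simpa using (Finset.sum_eq_zero_iff.1 hα) i (Finset.mem_univ i)
    exact this ▸ zero
  | succ N ih =>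
    intro α hα
    obtain ⟨i, -, hi⟩ : ∃ i ∈ Finset.univ, α i ≠ 0 :=
      Finset.exists_ne_zero_of_sum_ne_zero (by omega)
    have hle : Pi.single i 1 ≤ α := by
      intro j
      by_cases hj : j = i
      · subst hj; simpa using Nat.one_le_iff_ne_zero.2 hi
      · simp [hj]
    have hα' : α - Pi.single i 1 + Pi.single i 1 = α := tsub_add_cancel_of_le hle
    rw [← hα']
    refine add_single _ _ (ih _ ?_)
    have := congrArg (fun β : Fin n → ℕ => ∑ j, β j) hα'
    simp only [Pi.add_apply, Finset.sum_add_distrib, Finset.sum_pi_single', Finset.mem_univ,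
      if_true] at this
    omega

/-! ### Partial derivatives on an open set and integration by parts -/

section PartialD

variable {n : ℕ} {V K : Set (Fin n → ℝ)} {f g u φ : (Fin n → ℝ) → ℝ}

theorem ContDiffOn.partialD (hV : IsOpen V) (hf : ContDiffOn ℝ ∞ f V) (i : Fin n) :
    ContDiffOn ℝ ∞ (partialD i f) V :=
  (hf.fderiv_of_isOpen hV (m := ∞) (by simp)).clm_apply contDiffOn_const

theorem ContDiffOn.iterOp_partialD (hV : IsOpen V) (hf : ContDiffOn ℝ ∞ f V) (α : Fin n → ℕ) :
    ContDiffOn ℝ ∞ (iterOp _root_.partialD α f) V :=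
  iterOp_induction (fun f => ContDiffOn ℝ ∞ f V) (fun i _ h => h.partialD hV i) α hf

theorem ContDiffOn.differentiableAt_of_isOpen {E F : Type*} [NormedAddCommGroup E]
    [NormedSpace ℝ E] [NormedAddCommGroup F] [NormedSpace ℝ F] {W : Set E} {h : E → F}
    (hW : IsOpen W) (hh : ContDiffOn ℝ ∞ h W) {x : E} (hx : x ∈ W) : DifferentiableAt ℝ h x :=
  (hh.contDiffAt (hW.mem_nhds hx)).differentiableAt (by simp)

theorem partialD_congr (hV : IsOpen V) (h : Set.EqOn f g V) (i : Fin n) :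
    Set.EqOn (partialD i f) (partialD i g) V := by
  intro x hx
  have : f =ᶠ[nhds x] g := h.eventuallyEq_of_mem (hV.mem_nhds hx)
  simp only [partialD, this.fderiv_eq]

theorem iterOp_partialD_congr (hV : IsOpen V) (h : Set.EqOn f g V) (α : Fin n → ℕ) :
    Set.EqOn (iterOp partialD α f) (iterOp partialD α g) V :=
  iterOp_rel (fun _ f g => Set.EqOn f g V) (fun _ i _ _ h => partialD_congr hV h i) α (k := 0) h

theorem partialD_comm (hV : IsOpen V) (hf : ContDiffOn ℝ ∞ f V) (i j : Fin n) :
    Set.EqOn (partialD i (partialD j f)) (partialD j (partialD i f)) V := by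
  intro x hx
  have h2 : DifferentiableAt ℝ (fderiv ℝ f) x :=
    (hf.fderiv_of_isOpen hV (m := ∞) (by simp)).differentiableAt_of_isOpen hV hx
  have hs : IsSymmSndFDerivAt ℝ f x :=
    (hf.contDiffAt (hV.mem_nhds hx)).isSymmSndFDerivAt (by
      simpa using WithTop.coe_le_coe.2 (le_top : (2 : ℕ∞) ≤ ⊤))
  have key : ∀ i j : Fin n, partialD i (partialD j f) x =
      fderiv ℝ (fderiv ℝ f) x (Pi.single i 1) (Pi.single j 1) := by
    intro i j
    change fderiv ℝ (fun y => fderiv ℝ f y (Pi.single j 1)) x (Pi.single i 1) = _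
    rw [fderiv_clm_apply h2 (differentiableAt_const _)]
    simp
  rw [key, key, hs.eq]

theorem iterOp_partialD_add_single (hV : IsOpen V) (hf : ContDiffOn ℝ ∞ f V) (α : Fin n → ℕ)
    (i : Fin n) :
    Set.EqOn (iterOp partialD (α + Pi.single i 1) f) (partialD i (iterOp partialD α f)) V :=
  iterOp_add_single (P := fun f => ContDiffOn ℝ ∞ f V) (R := fun f g => Set.EqOn f g V)
    (fun _ _ _ => rfl) (fun _ _ _ h h' => h.trans h') (fun i _ h => h.partialD hV i)
    (fun i _ _ h => partialD_congr hV h i) (fun i j _ h => partialD_comm hV h i j) α i hf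

theorem partialD_iterOp_partialD (hV : IsOpen V) (hf : ContDiffOn ℝ ∞ f V) (α : Fin n → ℕ)
    (i : Fin n) :
    Set.EqOn (iterOp partialD α (partialD i f)) (partialD i (iterOp partialD α f)) V := by
  induction α using multiIdx_induction with
  | zero => simpa using Set.eqOn_refl _ _
  | add_single α j ih =>
    refine (iterOp_partialD_add_single hV (hf.partialD hV i) α j).trans ?_
    refine (partialD_congr hV ih j).trans ?_
    refine (partialD_comm hV (hf.iterOp_partialD hV α) j i).trans ?_
    exact (partialD_congr hV (iterOp_partialD_add_single hV hf α j) i).symm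

/-- `φ` is smooth on `V` and vanishes there outside `K`; for compact `K ⊆ V` this is a test function
on `V`, only its values on `V` being relevant. -/
structure IsTestOn (V K : Set (Fin n → ℝ)) (φ : (Fin n → ℝ) → ℝ) : Prop where
  contDiffOn : ContDiffOn ℝ ∞ φ V
  eq_zero : ∀ x ∈ V, x ∉ K → φ x = 0

namespace IsTestOn

theorem mul_left (hu : ContDiffOn ℝ ∞ u V) (hφ : IsTestOn V K φ) :
    IsTestOn V K (fun x => u x * φ x) :=
  ⟨hu.mul hφ.contDiffOn, fun x hx hK => by simp [hφ.eq_zero x hx hK]⟩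

theorem mul_right (hu : ContDiffOn ℝ ∞ u V) (hφ : IsTestOn V K φ) :
    IsTestOn V K (fun x => φ x * u x) :=
  ⟨hφ.contDiffOn.mul hu, fun x hx hK => by simp [hφ.eq_zero x hx hK]⟩

theorem sum {ι : Type*} {s : Finset ι} {Φ : ι → (Fin n → ℝ) → ℝ}
    (h : ∀ j ∈ s, IsTestOn V K (Φ j)) : IsTestOn V K (fun x => ∑ j ∈ s, Φ j x) :=
  ⟨ContDiffOn.sum fun j hj => (h j hj).contDiffOn,
    fun x hx hK => Finset.sum_eq_zero fun j hj => (h j hj).eq_zero x hx hK⟩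

theorem partialD (hV : IsOpen V) (hK : IsCompact K) (hφ : IsTestOn V K φ) (i : Fin n) :
    IsTestOn V K (partialD i φ) := by
  refine ⟨hφ.contDiffOn.partialD hV i, fun x hx hxK => ?_⟩
  have hO : IsOpen (V \ K) := hV.sdiff hK.isClosed
  have h0 : Set.EqOn φ (fun _ => 0) (V \ K) := fun y hy => hφ.eq_zero y hy.1 hy.2
  simpa [_root_.partialD] using partialD_congr hO h0 i ⟨hx, hxK⟩

theorem iterOp_partialD (hV : IsOpen V) (hK : IsCompact K) (hφ : IsTestOn V K φ)
    (α : Fin n → ℕ) : IsTestOn V K (iterOp _root_.partialD α φ) :=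
  iterOp_induction (fun φ => IsTestOn V K φ) (fun i _ h => h.partialD hV hK i) α hφ

theorem integrableOn (hV : IsOpen V) (hK : IsCompact K) (hKV : K ⊆ V) (hφ : IsTestOn V K φ) :
    MeasureTheory.IntegrableOn φ V := by
  have h1 : MeasureTheory.IntegrableOn φ K :=
    (hφ.contDiffOn.continuousOn.mono hKV).integrableOn_compact hK
  exact h1.of_forall_sdiff_eq_zero hV.measurableSet fun x hx => hφ.eq_zero x hx.1 hx.2

theorem contDiff_indicator (hV : IsOpen V) (hK : IsCompact K) (hKV : K ⊆ V)
    (hφ : IsTestOn V K φ) : ContDiff ℝ ∞ (V.indicator φ) := by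
  refine contDiff_iff_contDiffAt.2 fun x => ?_
  by_cases hx : x ∈ V
  · refine (hφ.contDiffOn.contDiffAt (hV.mem_nhds hx)).congr_of_eventuallyEq ?_
    filter_upwards [hV.mem_nhds hx] with y hy using Set.indicator_of_mem hy φ
  · refine (contDiffAt_const (c := (0 : ℝ))).congr_of_eventuallyEq ?_
    filter_upwards [hK.isClosed.isOpen_compl.mem_nhds fun h => hx (hKV h)] with y hy
    by_cases hyV : y ∈ V
    · rw [Set.indicator_of_mem hyV, hφ.eq_zero y hyV hy]
    · exact Set.indicator_of_notMem hyV φ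

theorem integral_partialD (hV : IsOpen V) (hK : IsCompact K) (hKV : K ⊆ V)
    (hφ : IsTestOn V K φ) (i : Fin n) : ∫ x in V, _root_.partialD i φ x = 0 := by
  have hw : ContDiff ℝ ∞ (V.indicator φ) := hφ.contDiff_indicator hV hK hKV
  have hsupp : ∀ x ∉ K, V.indicator φ x = 0 := fun x hx => by
    by_cases hxV : x ∈ V
    · rw [Set.indicator_of_mem hxV, hφ.eq_zero x hxV hx]
    · exact Set.indicator_of_notMem hxV φ
  have hind : ∀ x, fderiv ℝ (V.indicator φ) x (Pi.single i 1) =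
      V.indicator (_root_.partialD i φ) x := by
    intro x
    by_cases hxV : x ∈ V
    · rw [Set.indicator_of_mem hxV]
      exact partialD_congr hV (fun y hy => Set.indicator_of_mem hy φ) i hxV
    · rw [Set.indicator_of_notMem hxV]
      have : V.indicator φ =ᶠ[nhds x] fun _ => 0 := by
        filter_upwards [hK.isClosed.isOpen_compl.mem_nhds fun h => hxV (hKV h)] with y hy
          using hsupp y hy
      rw [this.fderiv_eq]; simp
  have hcs : HasCompactSupport (V.indicator φ) := HasCompactSupport.intro hK hsupp
  have h1 : MeasureTheory.Integrable (V.indicator φ) :=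
    hw.continuous.integrable_of_hasCompactSupport hcs
  have h2 : MeasureTheory.Integrable
      (fun x => fderiv ℝ (V.indicator φ) x (Pi.single i 1)) := by
    simp only [hind]
    rw [MeasureTheory.integrable_indicator_iff hV.measurableSet]
    exact (hφ.partialD hV hK i).integrableOn hV hK hKV
  have := integral_mul_fderiv_eq_neg_fderiv_mul_of_integrable (μ := MeasureTheory.volume)
    (f := fun _ : Fin n → ℝ => (1 : ℝ)) (g := V.indicator φ) (v := Pi.single i 1)
    (by simp) (by simpa using h2) (by simpa using h1) (by fun_prop)
    (fun x _ => hw.contDiffAt.differentiableAt (by simp))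
  rw [← MeasureTheory.integral_indicator hV.measurableSet]
  simpa [hind] using this

/-- Integration by parts for iterated partial derivatives of a test function. -/
theorem integral_mul_iterOp_partialD (hV : IsOpen V) (hK : IsCompact K) (hKV : K ⊆ V)
    (hu : ContDiffOn ℝ ∞ u V) (hφ : IsTestOn V K φ) (α : Fin n → ℕ) :
    ∫ x in V, u x * iterOp _root_.partialD α φ x =
      ∫ x in V, (-1 : ℝ) ^ (∑ i, α i) * iterOp _root_.partialD α u x * φ x := by
  induction α using multiIdx_induction generalizing u with
  | zero => simp
  | add_single α i ih =>
    have hα := hφ.iterOp_partialD hV hK α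
    have hprod : Set.EqOn (_root_.partialD i fun x => u x * iterOp _root_.partialD α φ x)
        (fun x => u x * _root_.partialD i (iterOp _root_.partialD α φ) x +
          _root_.partialD i u x * iterOp _root_.partialD α φ x) V := by
      intro x hx
      simp only [_root_.partialD]
      rw [fderiv_fun_mul (hu.differentiableAt_of_isOpen hV hx)
        (hα.contDiffOn.differentiableAt_of_isOpen hV hx)]
      simp [mul_comm]
    have h0 := (hα.mul_left hu).integral_partialD hV hK hKV i
    rw [MeasureTheory.setIntegral_congr_fun hV.measurableSet hprod,
      MeasureTheory.integral_add
        (((hα.partialD hV hK i).mul_left hu).integrableOn hV hK hKV)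
        ((hα.mul_left (hu.partialD hV i)).integrableOn hV hK hKV)] at h0
    rw [MeasureTheory.setIntegral_congr_fun hV.measurableSet
      (g := fun x => u x * _root_.partialD i (iterOp _root_.partialD α φ) x)
      (fun x hx => by simp only [iterOp_partialD_add_single hV hφ.contDiffOn α i hx]),
      eq_neg_of_add_eq_zero_left h0, ih (hu.partialD hV i), ← MeasureTheory.integral_neg]
    refine MeasureTheory.setIntegral_congr_fun hV.measurableSet fun x hx => ?_
    have hs : ∑ j, (α + Pi.single i 1 : Fin n → ℕ) j = ∑ j, α j + 1 := by
      simp [Finset.sum_add_distrib, Pi.single_apply]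
    simp only [hs, pow_succ, iterOp_partialD_add_single hV hu α i hx,
      partialD_iterOp_partialD hV hu α i hx]
    ring

end IsTestOn

/-- The fundamental lemma of the calculus of variations, for smooth functions on an open set. -/
theorem eqOn_zero_of_integral_test_mul (hV : IsOpen V) (hf : ContDiffOn ℝ ∞ f V)
    (h : ∀ φ : (Fin n → ℝ) → ℝ, ContDiff ℝ ∞ φ → HasCompactSupport φ → tsupport φ ⊆ V →
      ∫ x in V, φ x * f x = 0) : ∀ x ∈ V, f x = 0 := by
  have h1 := hV.ae_eq_zero_of_integral_contDiff_smul_eq_zero (μ := MeasureTheory.volume)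
    (hf.continuousOn.locallyIntegrableOn hV.measurableSet) (fun φ hφ hc hs => by
      rw [← h φ hφ hc hs, MeasureTheory.setIntegral_eq_integral_of_forall_compl_eq_zero]
      · rfl
      · intro x hx
        rw [image_eq_zero_of_notMem_tsupport fun hx' => hx (hs hx'), zero_mul])
  have h2 : f =ᵐ[MeasureTheory.volume.restrict V] fun _ => 0 :=
    (MeasureTheory.ae_restrict_iff' hV.measurableSet).2 h1
  exact MeasureTheory.Measure.eqOn_open_of_ae_eq h2 hV hf.continuousOn continuousOn_const

end PartialD

/-! ### Smooth functions of finitely many jet coordinates -/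

section JetSmooth

variable {n m k : ℕ} {T : Set ((Fin n → ℝ) × (Fin m → ℝ))} {F F' : JetPt n m → ℝ}
  {G : JetCoord n m k → ℝ} {z : JetPt n m}

/-- The points of the infinite jet space which lie over the set `T` of coordinates `(x^i, y^σ)`. -/
def jetsOver (T : Set ((Fin n → ℝ) × (Fin m → ℝ))) : Set (JetPt n m) :=
  {z | (z.1, fun σ => z.2 σ 0) ∈ T}

/-- The points of the jet space of order `k` which lie over the set `T` of coordinates
`(x^i, y^σ)`. -/
def jetCoordsOver (T : Set ((Fin n → ℝ) × (Fin m → ℝ))) (k : ℕ) : Set (JetCoord n m k) :=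
  {w | (w.1, fun σ => w.2 σ ⟨0, zero_mem_multiIdx n k⟩) ∈ T}

theorem isOpen_jetCoordsOver (hT : IsOpen T) (k : ℕ) : IsOpen (jetCoordsOver T k) :=
  hT.preimage (by fun_prop)

theorem JetPt.trunc_add (k : ℕ) (v w : JetPt n m) : (v + w).trunc k = v.trunc k + w.trunc k := rfl

/-- Over `T`, the function `F` of the jet coordinates is the pull-back of the smooth function `G` of
the jet coordinates of order `k`. -/
structure IsJetRep (T : Set ((Fin n → ℝ) × (Fin m → ℝ))) (k : ℕ) (F : JetPt n m → ℝ)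
    (G : JetCoord n m k → ℝ) : Prop where
  contDiffOn : ContDiffOn ℝ ∞ G (jetCoordsOver T k)
  eq : ∀ z ∈ jetsOver T, F z = G (z.trunc k)

/-- Over `T`, the function `F` is a smooth function of the jet coordinates of order `k`. -/
def IsJetSmooth (T : Set ((Fin n → ℝ) × (Fin m → ℝ))) (k : ℕ) (F : JetPt n m → ℝ) : Prop :=
  ∃ G, IsJetRep T k F G

/-- The coordinate vector `∂/∂y^σ_α`. -/
def jetBasis (σ : Fin m) (α : Fin n → ℕ) : JetPt n m := (0, Pi.single σ (Pi.single α 1))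

/-- The vector `∂/∂x^i + ∑ y^σ_{αi} ∂/∂y^σ_α` at `z`, along which the total derivative is taken. -/
def totalVec (i : Fin n) (z : JetPt n m) : JetPt n m :=
  (Pi.single i 1, fun σ α => z.2 σ (α + Pi.single i 1))

theorem jetPartialY_eq_lineDeriv (σ : Fin m) (α : Fin n → ℕ) (F : JetPt n m → ℝ)
    (z : JetPt n m) : jetPartialY σ α F z = lineDeriv ℝ F z (jetBasis σ α) := by
  have h : ∀ t : ℝ, F (z + t • jetBasis σ α) =
      F (z.1, Function.update z.2 σ (Function.update (z.2 σ) α (t + z.2 σ α))) := by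
    intro t
    congr 1
    refine Prod.ext (by simp [jetBasis]) ?_
    funext τ β
    by_cases hτ : τ = σ
    · subst hτ
      by_cases hβ : β = α
      · subst hβ; simp [jetBasis, add_comm]
      · simp [jetBasis, hβ]
    · simp [jetBasis, hτ]
  rw [lineDeriv, jetPartialY]
  simp only [h]
  rw [deriv_comp_add_const
    (f := fun t => F (z.1, Function.update z.2 σ (Function.update (z.2 σ) α t))), zero_add]

theorem jetPartialX_eq_lineDeriv (i : Fin n) (F : JetPt n m → ℝ) (z : JetPt n m) :
    jetPartialX i F z = lineDeriv ℝ F z (Pi.single i 1, 0) := by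
  have h : ∀ t : ℝ, F (z + t • ((Pi.single i 1, 0) : JetPt n m)) =
      F (Function.update z.1 i (t + z.1 i), z.2) := by
    intro t
    congr 1
    refine Prod.ext ?_ (by simp)
    funext j
    by_cases hj : j = i
    · subst hj; simp [add_comm]
    · simp [hj]
  rw [lineDeriv, jetPartialX]
  simp only [h]
  rw [deriv_comp_add_const (f := fun t => F (Function.update z.1 i t, z.2)), zero_add]

theorem IsJetRep.hasLineDerivAt (hT : IsOpen T) (hF : IsJetRep T k F G) (hz : z ∈ jetsOver T)
    (v : JetPt n m) : HasLineDerivAt ℝ F (fderiv ℝ G (z.trunc k) (v.trunc k)) z v := by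
  have hO := isOpen_jetCoordsOver hT k
  have hG : HasLineDerivAt ℝ G (fderiv ℝ G (z.trunc k) (v.trunc k)) (z.trunc k) (v.trunc k) :=
    (hF.contDiffOn.differentiableAt_of_isOpen hO (show z.trunc k ∈ jetCoordsOver T k from hz)
      ).hasFDerivAt.hasLineDerivAt _
  refine HasDerivAt.congr_of_eventuallyEq hG ?_
  have hc : Continuous fun t : ℝ => z.trunc k + t • v.trunc k := by fun_prop
  have : ∀ᶠ t : ℝ in nhds 0, z.trunc k + t • v.trunc k ∈ jetCoordsOver T k :=
    hc.continuousAt.eventually_mem (hO.mem_nhds (by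
      rw [zero_smul, add_zero]; exact hz))
  filter_upwards [this] with t ht using hF.eq (z + t • v) ht

theorem IsJetRep.lineDeriv_eq (hT : IsOpen T) (hF : IsJetRep T k F G) (hz : z ∈ jetsOver T)
    (v : JetPt n m) : lineDeriv ℝ F z v = fderiv ℝ G (z.trunc k) (v.trunc k) :=
  (hF.hasLineDerivAt hT hz v).lineDeriv

theorem IsJetRep.lineDeriv_const (hT : IsOpen T) (hF : IsJetRep T k F G) (v : JetPt n m) :
    IsJetRep T k (fun z => lineDeriv ℝ F z v) (fun w => fderiv ℝ G w (v.trunc k)) :=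
  ⟨(hF.contDiffOn.fderiv_of_isOpen (isOpen_jetCoordsOver hT k) (m := ∞) (by simp)).clm_apply
    contDiffOn_const, fun _ hz => hF.lineDeriv_eq hT hz v⟩

/-- The second derivatives of a smooth function of the jet coordinates are symmetric. -/
theorem IsJetRep.fderiv_fderiv_comm (hT : IsOpen T) (hF : IsJetRep T k F G)
    (hz : z ∈ jetsOver T) (v w : JetCoord n m k) :
    fderiv ℝ (fderiv ℝ G) (z.trunc k) v w = fderiv ℝ (fderiv ℝ G) (z.trunc k) w v :=
  ((hF.contDiffOn.contDiffAt ((isOpen_jetCoordsOver hT k).mem_nhds hz)).isSymmSndFDerivAt (by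
    simpa using WithTop.coe_le_coe.2 (le_top : (2 : ℕ∞) ≤ ⊤))).eq v w

theorem IsJetRep.differentiableAt_fderiv (hT : IsOpen T) (hF : IsJetRep T k F G)
    (hz : z ∈ jetsOver T) : DifferentiableAt ℝ (fderiv ℝ G) (z.trunc k) :=
  (hF.contDiffOn.fderiv_of_isOpen (isOpen_jetCoordsOver hT k) (m := ∞)
    (by simp)).differentiableAt_of_isOpen (isOpen_jetCoordsOver hT k)
    (show z.trunc k ∈ jetCoordsOver T k from hz)

theorem JetPt.trunc_eq_sum (v : Fin m → (Fin n → ℕ) → ℝ) :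
    JetPt.trunc k ((0, v) : JetPt n m) =
      ∑ σ, ∑ α ∈ multiIdx n k, v σ α • (jetBasis σ α : JetPt n m).trunc k := by
  refine Prod.ext (by simp [JetPt.trunc, jetBasis, Prod.fst_sum]) ?_
  funext τ β
  simp only [JetPt.trunc, jetBasis, Prod.smul_mk, Prod.snd_sum, Finset.sum_apply, Pi.smul_apply,
    smul_eq_mul]
  rw [Finset.sum_eq_single τ, Finset.sum_eq_single β.1]
  · simp
  · intro α _ hα; simp [hα.symm]
  · intro h; exact absurd β.2 h
  · intro σ _ hσ; simp [hσ.symm]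
  · simp

namespace IsJetSmooth

theorem mono (hF : IsJetSmooth T k F) {l : ℕ} (h : k ≤ l) : IsJetSmooth T l F := by
  obtain ⟨G, hG⟩ := hF
  have hmem : ∀ α ∈ multiIdx n k, α ∈ multiIdx n l := fun α hα =>
    mem_multiIdx.2 ((mem_multiIdx.1 hα).trans h)
  let R : JetCoord n m l → JetCoord n m k := fun w => (w.1, fun σ α => w.2 σ ⟨α.1, hmem _ α.2⟩)
  have hR : ContDiff ℝ ∞ R := by fun_prop
  exact ⟨G ∘ R, hG.contDiffOn.comp hR.contDiffOn fun w hw => hw, fun z hz => hG.eq z hz⟩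

theorem mul (hF : IsJetSmooth T k F) (hF' : IsJetSmooth T k F') :
    IsJetSmooth T k (fun z => F z * F' z) := by
  obtain ⟨G, hG⟩ := hF
  obtain ⟨G', hG'⟩ := hF'
  exact ⟨fun w => G w * G' w, hG.contDiffOn.mul hG'.contDiffOn, fun z hz => by
    rw [hG.eq z hz, hG'.eq z hz]⟩

theorem const_mul (a : ℝ) (hF : IsJetSmooth T k F) : IsJetSmooth T k (fun z => a * F z) := by
  obtain ⟨G, hG⟩ := hF
  exact ⟨fun w => a * G w, contDiffOn_const.mul hG.contDiffOn, fun z hz => by rw [hG.eq z hz]⟩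

theorem sum {ι : Type*} {s : Finset ι} {Φ : ι → JetPt n m → ℝ}
    (h : ∀ j ∈ s, IsJetSmooth T k (Φ j)) : IsJetSmooth T k (fun z => ∑ j ∈ s, Φ j z) := by
  choose! G hG using h
  exact ⟨fun w => ∑ j ∈ s, G j w, ContDiffOn.sum fun j hj => (hG j hj).contDiffOn,
    fun z hz => Finset.sum_congr rfl fun j hj => (hG j hj).eq z hz⟩

theorem hasLineDerivAt (hT : IsOpen T) (hF : IsJetSmooth T k F) (hz : z ∈ jetsOver T)
    (v : JetPt n m) : HasLineDerivAt ℝ F (lineDeriv ℝ F z v) z v := by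
  obtain ⟨G, hG⟩ := hF
  rw [hG.lineDeriv_eq hT hz]
  exact hG.hasLineDerivAt hT hz v

theorem jetPartialY (hT : IsOpen T) (hF : IsJetSmooth T k F) (σ : Fin m) (α : Fin n → ℕ) :
    IsJetSmooth T k (jetPartialY σ α F) := by
  obtain ⟨G, hG⟩ := hF
  have : _root_.jetPartialY σ α F = fun z => lineDeriv ℝ F z (jetBasis σ α) :=
    funext fun z => jetPartialY_eq_lineDeriv σ α F z
  rw [this]
  exact ⟨_, hG.lineDeriv_const hT _⟩

theorem jetPartialY_eq_zero (hT : IsOpen T) (hF : IsJetSmooth T k F) (hz : z ∈ jetsOver T)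
    (σ : Fin m) {α : Fin n → ℕ} (hα : α ∉ multiIdx n k) : _root_.jetPartialY σ α F z = 0 := by
  obtain ⟨G, hG⟩ := hF
  have : (jetBasis σ α : JetPt n m).trunc k = 0 := by
    refine Prod.ext rfl ?_
    funext τ β
    have : β.1 ≠ α := fun h => hα (h ▸ β.2)
    by_cases hτ : τ = σ
    · subst hτ; simp [JetPt.trunc, jetBasis, this]
    · simp [JetPt.trunc, jetBasis, hτ]
  rw [jetPartialY_eq_lineDeriv, hG.lineDeriv_eq hT hz, this, map_zero]

/-- The derivative along a vertical vector, in terms of the partial derivatives. -/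
theorem sum_mul_jetPartialY (hT : IsOpen T) (hF : IsJetSmooth T k F) (hz : z ∈ jetsOver T)
    (v : Fin m → (Fin n → ℕ) → ℝ) :
    ∑ σ, ∑ α ∈ multiIdx n k, v σ α * _root_.jetPartialY σ α F z = lineDeriv ℝ F z (0, v) := by
  obtain ⟨G, hG⟩ := hF
  simp only [jetPartialY_eq_lineDeriv, hG.lineDeriv_eq hT hz, JetPt.trunc_eq_sum, map_sum,
    map_smul, smul_eq_mul]

end IsJetSmooth

theorem IsJetRep.totalD_eq (hT : IsOpen T) (hF : IsJetRep T k F G) (hz : z ∈ jetsOver T)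
    (i : Fin n) : totalD i F z = fderiv ℝ G (z.trunc k) ((totalVec i z).trunc k) := by
  have hS : IsJetSmooth T k F := ⟨G, hF⟩
  have hsum : ∀ σ, ∑ᶠ α : Fin n → ℕ, z.2 σ (α + Pi.single i 1) * jetPartialY σ α F z =
      ∑ α ∈ multiIdx n k, z.2 σ (α + Pi.single i 1) * jetPartialY σ α F z := by
    intro σ
    refine finsum_eq_sum_of_support_subset _ fun α hα => ?_
    by_contra h
    exact hα (by simp only [hS.jetPartialY_eq_zero hT hz σ h, mul_zero])
  have hv : totalVec i z = ((Pi.single i 1, 0) : JetPt n m) + (0, (totalVec i z).2) := by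
    simp [totalVec]
  simp only [totalD, hsum]
  rw [hv, JetPt.trunc_add, map_add, ← hF.lineDeriv_eq hT hz, ← hF.lineDeriv_eq hT hz,
    jetPartialX_eq_lineDeriv, ← hS.sum_mul_jetPartialY hT hz]
  rfl

theorem IsJetRep.totalD (hT : IsOpen T) (hF : IsJetRep T k F G) (i : Fin n) :
    IsJetSmooth T (k + 1) (totalD i F) := by
  have hmem : ∀ α ∈ multiIdx n k, α ∈ multiIdx n (k + 1) := fun α hα =>
    mem_multiIdx.2 ((mem_multiIdx.1 hα).trans (Nat.le_succ k))
  have hmem' : ∀ α ∈ multiIdx n k, α + Pi.single i 1 ∈ multiIdx n (k + 1) := fun α hα => by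
    have := mem_multiIdx.1 hα
    rw [mem_multiIdx]
    simpa [Finset.sum_add_distrib, Pi.single_apply] using this
  let R : JetCoord n m (k + 1) → JetCoord n m k :=
    fun w => (w.1, fun σ α => w.2 σ ⟨α.1, hmem _ α.2⟩)
  let S : JetCoord n m (k + 1) → JetCoord n m k :=
    fun w => (Pi.single i 1, fun σ α => w.2 σ ⟨α.1 + Pi.single i 1, hmem' _ α.2⟩)
  have hR : ContDiff ℝ ∞ R := by fun_prop
  have hS : ContDiff ℝ ∞ S := by fun_prop
  refine ⟨fun w => fderiv ℝ G (R w) (S w), ?_, fun z hz => hF.totalD_eq hT hz i⟩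
  exact ((hF.contDiffOn.fderiv_of_isOpen (isOpen_jetCoordsOver hT k) (m := ∞) (by simp)).comp
    hR.contDiffOn fun w hw => hw).clm_apply hS.contDiffOn

namespace IsJetSmooth

theorem totalDs (hT : IsOpen T) (hF : IsJetSmooth T k F) (α : Fin n → ℕ) :
    IsJetSmooth T (k + ∑ i, α i) (totalDs α F) :=
  iterOp_rel (D' := totalD) (fun k F _ => IsJetSmooth T k F)
    (fun _ i _ _ h => h.elim fun _ hG => hG.totalD hT i) α (b := F) hF

theorem eulerExpr (hT : IsOpen T) (hF : IsJetSmooth T k F) (σ : Fin m) :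
    IsJetSmooth T (k + k) (eulerExpr k F σ) :=
  IsJetSmooth.sum fun α hα => const_mul _ (((hF.jetPartialY hT σ α).totalDs hT α).mono
    (Nat.add_le_add_left (mem_multiIdx.1 hα) k))

end IsJetSmooth

theorem jetPartialY_mul (hT : IsOpen T) (hF : IsJetSmooth T k F) (hF' : IsJetSmooth T k F')
    (hz : z ∈ jetsOver T) (σ : Fin m) (α : Fin n → ℕ) :
    jetPartialY σ α (fun z => F z * F' z) z =
      jetPartialY σ α F z * F' z + F z * jetPartialY σ α F' z := by
  simp only [jetPartialY_eq_lineDeriv]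
  have h : HasDerivAt (fun t : ℝ => F (z + t • jetBasis σ α) * F' (z + t • jetBasis σ α)) _ 0 :=
    HasDerivAt.mul (hF.hasLineDerivAt hT hz (jetBasis σ α))
      (hF'.hasLineDerivAt hT hz (jetBasis σ α))
  simpa [lineDeriv] using h.deriv

theorem jetPartialY_sum {ι : Type*} {s : Finset ι} {Φ : ι → JetPt n m → ℝ} (hT : IsOpen T)
    (h : ∀ j ∈ s, IsJetSmooth T k (Φ j)) (hz : z ∈ jetsOver T) (σ : Fin m) (α : Fin n → ℕ) :
    jetPartialY σ α (fun z => ∑ j ∈ s, Φ j z) z = ∑ j ∈ s, jetPartialY σ α (Φ j) z := by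
  simp only [jetPartialY_eq_lineDeriv]
  exact (HasDerivAt.fun_sum fun j hj => (h j hj).hasLineDerivAt hT hz (jetBasis σ α)).deriv

end JetSmooth

/-! ### Jet coordinates along a section and linearization -/

section SecondDerivative

variable {E E' : Type*} [NormedAddCommGroup E] [NormedSpace ℝ E] [NormedAddCommGroup E']
  [NormedSpace ℝ E'] {G : E → ℝ}

theorem fderiv_fderiv_apply_comp {p q : E' → E} {ξ : E'}
    (hG : DifferentiableAt ℝ (fderiv ℝ G) (p ξ)) (hp : DifferentiableAt ℝ p ξ)
    (hq : DifferentiableAt ℝ q ξ) (e : E') :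
    fderiv ℝ (fun ξ => fderiv ℝ G (p ξ) (q ξ)) ξ e =
      fderiv ℝ (fderiv ℝ G) (p ξ) (fderiv ℝ p ξ e) (q ξ) + fderiv ℝ G (p ξ) (fderiv ℝ q ξ e) := by
  have h := ((hG.hasFDerivAt.comp ξ hp.hasFDerivAt).clm_apply hq.hasFDerivAt).fderiv
  have h' := congrArg (· e) h
  simp only [add_apply, ContinuousLinearMap.comp_apply,
    ContinuousLinearMap.flip_apply, Function.comp_apply] at h'
  rw [add_comm]
  exact h'

theorem hasDerivAt_fderiv_apply_line {x : E} (hG : DifferentiableAt ℝ (fderiv ℝ G) x)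
    (v w w' : E) :
    HasDerivAt (fun t : ℝ => fderiv ℝ G (x + t • v) (w + t • w'))
      (fderiv ℝ (fderiv ℝ G) x v w + fderiv ℝ G x w') 0 := by
  have hline : ∀ a b : E, HasFDerivAt (fun t : ℝ => a + t • b)
      ((1 : ℝ →L[ℝ] ℝ).smulRight b) 0 := fun a b =>
    ((hasFDerivAt_id (𝕜 := ℝ) (0 : ℝ)).smul_const b).const_add a
  have hx : x + (0 : ℝ) • v = x := by rw [zero_smul, add_zero]
  have hG' : DifferentiableAt ℝ (fderiv ℝ G) ((fun t : ℝ => x + t • v) 0) := by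
    change DifferentiableAt ℝ (fderiv ℝ G) (x + (0 : ℝ) • v)
    rwa [hx]
  have hd : DifferentiableAt ℝ (fun t : ℝ => fderiv ℝ G (x + t • v) (w + t • w')) 0 :=
    (hG'.comp (0 : ℝ) (hline x v).differentiableAt).clm_apply (hline w w').differentiableAt
  have h := fderiv_fderiv_apply_comp (p := fun t : ℝ => x + t • v) hG' (hline x v).differentiableAt
    (hline w w').differentiableAt 1
  rw [(hline x v).fderiv, (hline w w').fderiv] at h
  have h' := hd.hasFDerivAt.hasDerivAt
  rw [h] at h'
  simpa using h'

end SecondDerivative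

section Along

variable {n m k : ℕ} {T : Set ((Fin n → ℝ) × (Fin m → ℝ))} {V K : Set (Fin n → ℝ)}
  {s φ ψ : (Fin n → ℝ) → Fin m → ℝ} {F : JetPt n m → ℝ} {G : JetCoord n m k → ℝ}
  {ξ : Fin n → ℝ}

/-- The partial derivatives of all orders of an `ℝ^m`-valued function. -/
noncomputable def secDerivs (s : (Fin n → ℝ) → Fin m → ℝ) (ξ : Fin n → ℝ) : Fin m → (Fin n → ℕ) → ℝ :=
  fun σ α => iterOp partialD α (fun ζ => s ζ σ) ξ

/-- The jet coordinates of the section `ξ ↦ (ξ, s ξ)`. -/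
noncomputable def secJet (s : (Fin n → ℝ) → Fin m → ℝ) (ξ : Fin n → ℝ) : JetPt n m := (ξ, secDerivs s ξ)

/-- `s` is the coordinate expression of a smooth section over `V` with values in `T`. -/
structure IsSecOn (T : Set ((Fin n → ℝ) × (Fin m → ℝ))) (V : Set (Fin n → ℝ))
    (s : (Fin n → ℝ) → Fin m → ℝ) : Prop where
  isOpen : IsOpen V
  isOpen_target : IsOpen T
  contDiffOn : ∀ σ, ContDiffOn ℝ ∞ (fun ξ => s ξ σ) V
  mem : ∀ ξ ∈ V, (ξ, s ξ) ∈ T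

/-- The derivative of `F` along the section `s` in the direction of the variation `ψ`:
`∑ ∂^α ψ^σ ∂F/∂y^σ_α`. -/
noncomputable def linearizeAt (s ψ : (Fin n → ℝ) → Fin m → ℝ) (F : JetPt n m → ℝ) : (Fin n → ℝ) → ℝ :=
  fun ξ => lineDeriv ℝ F (secJet s ξ) (0, secDerivs ψ ξ)

theorem contDiffOn_trunc_secDerivs (hV : IsOpen V) (hψ : ∀ σ, ContDiffOn ℝ ∞ (fun ξ => ψ ξ σ) V) :
    ContDiffOn ℝ ∞ (fun ξ => JetPt.trunc k ((0, secDerivs ψ ξ) : JetPt n m)) V :=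
  contDiffOn_const.prodMk (contDiffOn_pi.2 fun σ => contDiffOn_pi.2 fun α =>
    (hψ σ).iterOp_partialD hV α.1)

theorem contDiffOn_trunc_secJet (hV : IsOpen V) (hs : ∀ σ, ContDiffOn ℝ ∞ (fun ξ => s ξ σ) V) :
    ContDiffOn ℝ ∞ (fun ξ => (secJet s ξ).trunc k) V :=
  contDiffOn_id.prodMk (contDiffOn_pi.2 fun σ => contDiffOn_pi.2 fun α =>
    (hs σ).iterOp_partialD hV α.1)

theorem fderiv_trunc_secDerivs (hV : IsOpen V) (hψ : ∀ σ, ContDiffOn ℝ ∞ (fun ξ => ψ ξ σ) V)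
    (hξ : ξ ∈ V) (i : Fin n) :
    fderiv ℝ (fun ξ => JetPt.trunc k ((0, secDerivs ψ ξ) : JetPt n m)) ξ (Pi.single i 1) =
      JetPt.trunc k ((0, (totalVec i (secJet ψ ξ)).2) : JetPt n m) := by
  have hd : ∀ σ (α : {α : Fin n → ℕ // α ∈ multiIdx n k}), HasFDerivAt
      (iterOp partialD α.1 (fun ζ => ψ ζ σ)) (fderiv ℝ (iterOp partialD α.1 (fun ζ => ψ ζ σ)) ξ) ξ :=
    fun σ α => (((hψ σ).iterOp_partialD hV α.1).differentiableAt_of_isOpen hV hξ).hasFDerivAt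
  have h := (hasFDerivAt_const (𝕜 := ℝ) (0 : Fin n → ℝ) ξ).prodMk
    (hasFDerivAt_pi.2 fun σ => hasFDerivAt_pi.2 fun α => hd σ α)
  have h' : HasFDerivAt (fun ξ => JetPt.trunc k ((0, secDerivs ψ ξ) : JetPt n m)) _ ξ := h
  rw [h'.fderiv]
  refine Prod.ext (by simp [JetPt.trunc]) ?_
  funext σ α
  exact (iterOp_partialD_add_single hV (hψ σ) α.1 i hξ).symm

/-- The jet prolongation of a section is tangent to the vector fields which define the total
derivatives. -/
theorem fderiv_trunc_secJet (hV : IsOpen V) (hs : ∀ σ, ContDiffOn ℝ ∞ (fun ξ => s ξ σ) V)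
    (hξ : ξ ∈ V) (i : Fin n) :
    fderiv ℝ (fun ξ => (secJet s ξ).trunc k) ξ (Pi.single i 1) =
      (totalVec i (secJet s ξ)).trunc k := by
  have hd : ∀ σ (α : {α : Fin n → ℕ // α ∈ multiIdx n k}), HasFDerivAt
      (iterOp partialD α.1 (fun ζ => s ζ σ)) (fderiv ℝ (iterOp partialD α.1 (fun ζ => s ζ σ)) ξ) ξ :=
    fun σ α => (((hs σ).iterOp_partialD hV α.1).differentiableAt_of_isOpen hV hξ).hasFDerivAt
  have h := (hasFDerivAt_id (𝕜 := ℝ) ξ).prodMk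
    (hasFDerivAt_pi.2 fun σ => hasFDerivAt_pi.2 fun α => hd σ α)
  have h' : HasFDerivAt (fun ξ => (secJet s ξ).trunc k) _ ξ := h
  rw [h'.fderiv]
  refine Prod.ext rfl ?_
  funext σ α
  exact (iterOp_partialD_add_single hV (hs σ) α.1 i hξ).symm

namespace IsSecOn

theorem secJet_mem (h : IsSecOn T V s) (hξ : ξ ∈ V) : secJet s ξ ∈ jetsOver T := by
  have : (fun σ => secDerivs s ξ σ 0) = s ξ := by funext σ; simp [secDerivs]
  change (ξ, fun σ => secDerivs s ξ σ 0) ∈ T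
  rw [this]
  exact h.mem ξ hξ

theorem contDiffOn_comp_secJet (h : IsSecOn T V s) (hF : IsJetSmooth T k F) :
    ContDiffOn ℝ ∞ (fun ξ => F (secJet s ξ)) V := by
  obtain ⟨G, hG⟩ := hF
  exact (hG.contDiffOn.comp (contDiffOn_trunc_secJet h.isOpen h.contDiffOn)
    fun ξ hξ => h.secJet_mem hξ).congr fun ξ hξ => hG.eq _ (h.secJet_mem hξ)

/-- Along a section, total derivatives are partial derivatives with respect to the base
coordinates. -/
theorem totalD_secJet (h : IsSecOn T V s) (hF : IsJetSmooth T k F) (i : Fin n) (hξ : ξ ∈ V) :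
    totalD i F (secJet s ξ) = partialD i (fun ξ => F (secJet s ξ)) ξ := by
  obtain ⟨G, hG⟩ := hF
  have hc : Set.EqOn (fun ξ => F (secJet s ξ)) (fun ξ => G ((secJet s ξ).trunc k)) V :=
    fun ξ hξ => hG.eq _ (h.secJet_mem hξ)
  rw [partialD_congr h.isOpen hc i hξ, hG.totalD_eq h.isOpen_target (h.secJet_mem hξ), partialD,
    ← fderiv_trunc_secJet h.isOpen h.contDiffOn hξ]
  have hGd : DifferentiableAt ℝ G ((secJet s ξ).trunc k) :=
    hG.contDiffOn.differentiableAt_of_isOpen (isOpen_jetCoordsOver h.isOpen_target k)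
      (h.secJet_mem hξ)
  exact (congrArg (· (Pi.single i 1)) (fderiv_comp ξ hGd
    ((contDiffOn_trunc_secJet h.isOpen h.contDiffOn).differentiableAt_of_isOpen h.isOpen hξ))).symm

theorem totalDs_secJet (h : IsSecOn T V s) (hF : IsJetSmooth T k F) (α : Fin n → ℕ) :
    Set.EqOn (fun ξ => totalDs α F (secJet s ξ))
      (iterOp partialD α fun ξ => F (secJet s ξ)) V :=
  (iterOp_rel (fun k F f => IsJetSmooth T k F ∧ Set.EqOn (fun ξ => F (secJet s ξ)) f V)
    (fun _ i _ _ hab => ⟨hab.1.elim fun _ hG => hG.totalD h.isOpen_target i,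
      fun _ hξ => (h.totalD_secJet hab.1 i hξ).trans (partialD_congr h.isOpen hab.2 i hξ)⟩)
    α (k := k) ⟨hF, fun _ _ => rfl⟩).2

theorem contDiffOn_linearizeAt (h : IsSecOn T V s) (hF : IsJetSmooth T k F)
    (hψ : ∀ σ, ContDiffOn ℝ ∞ (fun ξ => ψ ξ σ) V) : ContDiffOn ℝ ∞ (linearizeAt s ψ F) V := by
  obtain ⟨G, hG⟩ := hF
  have h1 := (hG.contDiffOn.fderiv_of_isOpen (isOpen_jetCoordsOver h.isOpen_target k)
    (m := ∞) (by simp)).comp (contDiffOn_trunc_secJet h.isOpen h.contDiffOn)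
    fun ξ hξ => h.secJet_mem hξ
  exact (h1.clm_apply (contDiffOn_trunc_secDerivs h.isOpen hψ)).congr
    fun ξ hξ => hG.lineDeriv_eq h.isOpen_target (h.secJet_mem hξ) _

theorem isTestOn_linearizeAt (h : IsSecOn T V s) (hK : IsCompact K) (hF : IsJetSmooth T k F)
    (hψ : ∀ σ, IsTestOn V K (fun ξ => ψ ξ σ)) : IsTestOn V K (linearizeAt s ψ F) := by
  refine ⟨h.contDiffOn_linearizeAt hF fun σ => (hψ σ).contDiffOn, fun ξ hξ hξK => ?_⟩
  have : secDerivs ψ ξ = 0 := by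
    funext σ α
    exact ((hψ σ).iterOp_partialD h.isOpen hK α).eq_zero ξ hξ hξK
  rw [linearizeAt, this]
  exact lineDeriv_zero

theorem linearizeAt_eq_sum (h : IsSecOn T V s) (hF : IsJetSmooth T k F) (hξ : ξ ∈ V) :
    linearizeAt s ψ F ξ =
      ∑ σ, ∑ α ∈ multiIdx n k, iterOp partialD α (fun ζ => ψ ζ σ) ξ *
        jetPartialY σ α F (secJet s ξ) :=
  (hF.sum_mul_jetPartialY h.isOpen_target (h.secJet_mem hξ) _).symm

/-- Linearization takes total derivatives to partial derivatives: the prolongation of a vertical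
vector field commutes with total derivatives. -/
theorem linearizeAt_totalD (h : IsSecOn T V s) (hF : IsJetSmooth T k F)
    (hψ : ∀ σ, ContDiffOn ℝ ∞ (fun ξ => ψ ξ σ) V) (i : Fin n) :
    Set.EqOn (linearizeAt s ψ (totalD i F)) (partialD i (linearizeAt s ψ F)) V := by
  obtain ⟨G, hG⟩ := hF
  intro ξ hξ
  have hz := h.secJet_mem hξ
  have hT := h.isOpen_target
  have hG2 := hG.differentiableAt_fderiv hT hz
  -- the left hand side: differentiate `fderiv G` at a point moving along the vertical vector
  set v : JetPt n m := (0, secDerivs ψ ξ) with hv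
  set v' : JetPt n m := (0, (totalVec i (secJet ψ ξ)).2) with hv'
  have hl : linearizeAt s ψ (totalD i F) ξ =
      fderiv ℝ (fderiv ℝ G) ((secJet s ξ).trunc k) (v.trunc k)
        ((totalVec i (secJet s ξ)).trunc k) +
      fderiv ℝ G ((secJet s ξ).trunc k) (v'.trunc k) := by
    have hvec : ∀ t : ℝ, (totalVec i (secJet s ξ + t • v)).trunc k =
        (totalVec i (secJet s ξ)).trunc k + t • v'.trunc k := fun t => by
      refine Prod.ext (by simp [JetPt.trunc, totalVec, hv']) rfl
    have hd := hasDerivAt_fderiv_apply_line hG2 (v.trunc k) ((totalVec i (secJet s ξ)).trunc k)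
      (v'.trunc k)
    have hmem : ∀ᶠ t : ℝ in nhds 0, secJet s ξ + t • v ∈ jetsOver T := by
      have hO := isOpen_jetCoordsOver hT k (n := n) (m := m)
      have hc : Continuous fun t : ℝ => (secJet s ξ).trunc k + t • v.trunc k := by fun_prop
      refine hc.continuousAt.eventually_mem (hO.mem_nhds ?_)
      rw [zero_smul, add_zero]; exact hz
    refine (HasDerivAt.congr_of_eventuallyEq hd ?_).deriv
    filter_upwards [hmem] with t ht
    rw [hG.totalD_eq hT ht, hvec]
    rfl
  -- the right hand side: differentiate `fderiv G` along the section
  have hr : partialD i (linearizeAt s ψ F) ξ =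
      fderiv ℝ (fderiv ℝ G) ((secJet s ξ).trunc k) ((totalVec i (secJet s ξ)).trunc k)
        (v.trunc k) +
      fderiv ℝ G ((secJet s ξ).trunc k) (v'.trunc k) := by
    have hc : Set.EqOn (linearizeAt s ψ F) (fun ξ => fderiv ℝ G ((secJet s ξ).trunc k)
        (JetPt.trunc k ((0, secDerivs ψ ξ) : JetPt n m))) V :=
      fun ξ hξ => hG.lineDeriv_eq hT (h.secJet_mem hξ) _
    have hsd := (contDiffOn_trunc_secJet (k := k) h.isOpen
      h.contDiffOn).differentiableAt_of_isOpen h.isOpen hξ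
    have hψd := (contDiffOn_trunc_secDerivs (k := k) h.isOpen
      hψ).differentiableAt_of_isOpen h.isOpen hξ
    rw [partialD_congr h.isOpen hc i hξ, partialD,
      fderiv_fderiv_apply_comp (p := fun ξ => (secJet s ξ).trunc k) hG2 hsd hψd,
      fderiv_trunc_secJet h.isOpen h.contDiffOn hξ, fderiv_trunc_secDerivs h.isOpen hψ hξ]
  rw [hl, hr, hG.fderiv_fderiv_comm hT hz]

theorem linearizeAt_totalDs (h : IsSecOn T V s) (hF : IsJetSmooth T k F)
    (hψ : ∀ σ, ContDiffOn ℝ ∞ (fun ξ => ψ ξ σ) V) (α : Fin n → ℕ) :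
    Set.EqOn (linearizeAt s ψ (totalDs α F)) (iterOp partialD α (linearizeAt s ψ F)) V :=
  (iterOp_rel (fun k F f => IsJetSmooth T k F ∧ Set.EqOn (linearizeAt s ψ F) f V)
    (fun _ i _ _ hab => ⟨hab.1.elim fun _ hG => hG.totalD h.isOpen_target i,
      (h.linearizeAt_totalD hab.1 hψ i).trans (partialD_congr h.isOpen hab.2 i)⟩)
    α (k := k) ⟨hF, fun _ _ => rfl⟩).2

theorem linearizeAt_eulerExpr (h : IsSecOn T V s) (hF : IsJetSmooth T k F)
    (hψ : ∀ σ, ContDiffOn ℝ ∞ (fun ξ => ψ ξ σ) V) (σ : Fin m) (hξ : ξ ∈ V) :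
    linearizeAt s ψ (eulerExpr k F σ) ξ = ∑ α ∈ multiIdx n k, (-1 : ℝ) ^ (∑ i, α i) *
      iterOp partialD α (linearizeAt s ψ (jetPartialY σ α F)) ξ := by
  have hT := h.isOpen_target
  have hd : ∀ α ∈ multiIdx n k, HasDerivAt (fun t : ℝ => (-1 : ℝ) ^ (∑ i, α i) *
      totalDs α (jetPartialY σ α F) (secJet s ξ + t • (0, secDerivs ψ ξ)))
      ((-1 : ℝ) ^ (∑ i, α i) * linearizeAt s ψ (totalDs α (jetPartialY σ α F)) ξ) 0 :=
    fun α _ => HasDerivAt.const_mul _ (((hF.jetPartialY hT σ α).totalDs hT α).hasLineDerivAt hT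
      (h.secJet_mem hξ) _)
  refine (HasDerivAt.fun_sum hd).deriv.trans (Finset.sum_congr rfl fun α _ => ?_)
  rw [h.linearizeAt_totalDs (hF.jetPartialY hT σ α) hψ α hξ]

/-- The symmetry of the second variation of a density. -/
theorem sum_linearizeAt_jetPartialY_comm (h : IsSecOn T V s) (hF : IsJetSmooth T k F)
    (hξ : ξ ∈ V) :
    ∑ σ, ∑ α ∈ multiIdx n k, iterOp partialD α (fun ζ => φ ζ σ) ξ *
        linearizeAt s ψ (jetPartialY σ α F) ξ =
      ∑ σ, ∑ α ∈ multiIdx n k, iterOp partialD α (fun ζ => ψ ζ σ) ξ *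
        linearizeAt s φ (jetPartialY σ α F) ξ := by
  obtain ⟨G, hG⟩ := hF
  have hT := h.isOpen_target
  have hz := h.secJet_mem hξ
  have key : ∀ φ ψ : (Fin n → ℝ) → Fin m → ℝ,
      ∑ σ, ∑ α ∈ multiIdx n k, iterOp partialD α (fun ζ => φ ζ σ) ξ *
        linearizeAt s ψ (jetPartialY σ α F) ξ =
      fderiv ℝ (fderiv ℝ G) ((secJet s ξ).trunc k)
        (JetPt.trunc k ((0, secDerivs ψ ξ) : JetPt n m))
        (JetPt.trunc k ((0, secDerivs φ ξ) : JetPt n m)) := by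
    intro φ ψ
    rw [JetPt.trunc_eq_sum (secDerivs φ ξ)]
    simp only [map_sum, map_smul, smul_eq_mul]
    refine Finset.sum_congr rfl fun σ _ => Finset.sum_congr rfl fun α _ => ?_
    have hfun : jetPartialY σ α F = fun z => lineDeriv ℝ F z (jetBasis σ α) :=
      funext fun z => jetPartialY_eq_lineDeriv σ α F z
    rw [linearizeAt, hfun, (hG.lineDeriv_const hT (jetBasis σ α)).lineDeriv_eq hT hz,
      fderiv_clm_apply (hG.differentiableAt_fderiv hT hz) (differentiableAt_const _)]
    simp [secDerivs]
  rw [key, key, hG.fderiv_fderiv_comm hT hz]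

end IsSecOn

end Along

/-! ### Integral identities and self-adjointness along a section -/

section Variation

variable {n m r : ℕ} {T : Set ((Fin n → ℝ) × (Fin m → ℝ))} {V K : Set (Fin n → ℝ)}
  {s φ ψ : (Fin n → ℝ) → Fin m → ℝ} {F : JetPt n m → ℝ} {ξ : Fin n → ℝ}

theorem IsTestOn.of_tsupport_subset {f : (Fin n → ℝ) → ℝ} (hf : ContDiff ℝ ∞ f) :
    IsTestOn V (tsupport f) f :=
  ⟨hf.contDiffOn, fun _ _ hx => image_eq_zero_of_notMem_tsupport hx⟩

theorem IsTestOn.integral_sum_congr {ι : Type*} {S : Finset ι} {a b : ι → (Fin n → ℝ) → ℝ}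
    (hV : IsOpen V) (hK : IsCompact K) (hKV : K ⊆ V) (ha : ∀ j ∈ S, IsTestOn V K (a j))
    (hb : ∀ j ∈ S, IsTestOn V K (b j)) (h : ∀ j ∈ S, ∫ x in V, a j x = ∫ x in V, b j x) :
    ∫ x in V, ∑ j ∈ S, a j x = ∫ x in V, ∑ j ∈ S, b j x := by
  rw [MeasureTheory.integral_finsetSum _ fun j hj => (ha j hj).integrableOn hV hK hKV,
    MeasureTheory.integral_finsetSum _ fun j hj => (hb j hj).integrableOn hV hK hKV]
  exact Finset.sum_congr rfl h

/-- Integration by parts for a sum of terms of several orders, one of the two factors being a test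
function in each of the terms. -/
theorem integral_sum_adjoint {ι : Type*} {S : Finset ι} {N : ℕ} {f : ι → (Fin n → ℝ) → ℝ}
    {g : ι → (Fin n → ℕ) → (Fin n → ℝ) → ℝ} (hV : IsOpen V) (hK : IsCompact K) (hKV : K ⊆ V)
    (hf : ∀ j, ContDiffOn ℝ ∞ (f j) V) (hg : ∀ j α, ContDiffOn ℝ ∞ (g j α) V)
    (htest : (∀ j, IsTestOn V K (f j)) ∨ ∀ j α, IsTestOn V K (g j α)) :
    ∫ x in V, ∑ j ∈ S, f j x *
        ∑ α ∈ multiIdx n N, (-1 : ℝ) ^ (∑ i, α i) * iterOp partialD α (g j α) x =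
      ∫ x in V, ∑ j ∈ S, ∑ α ∈ multiIdx n N, iterOp partialD α (f j) x * g j α x := by
  have hl : ∀ j α, IsTestOn V K
      (fun x => f j x * ((-1 : ℝ) ^ (∑ i, α i) * iterOp partialD α (g j α) x)) := by
    intro j α
    rcases htest with h | h
    · exact (h j).mul_right (contDiffOn_const.mul ((hg j α).iterOp_partialD hV α))
    · exact (((h j α).iterOp_partialD hV hK α).mul_left contDiffOn_const).mul_left (hf j)
  have hr : ∀ j α, IsTestOn V K (fun x => iterOp partialD α (f j) x * g j α x) := by
    intro j α
    rcases htest with h | h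
    · exact ((h j).iterOp_partialD hV hK α).mul_right (hg j α)
    · exact (h j α).mul_left ((hf j).iterOp_partialD hV α)
  simp only [Finset.mul_sum]
  refine IsTestOn.integral_sum_congr hV hK hKV (fun j _ => IsTestOn.sum fun α _ => hl j α)
    (fun j _ => IsTestOn.sum fun α _ => hr j α) fun j _ => ?_
  refine IsTestOn.integral_sum_congr hV hK hKV (fun α _ => hl j α) (fun α _ => hr j α)
    fun α _ => ?_
  have hsign : (-1 : ℝ) ^ (∑ i, α i) * (-1 : ℝ) ^ (∑ i, α i) = 1 := by
    rw [← mul_pow]; simp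
  rcases htest with h | h
  · have := (h j).integral_mul_iterOp_partialD hV hK hKV (hg j α) α
    rw [show (fun x => iterOp partialD α (f j) x * g j α x) =
      fun x => g j α x * iterOp partialD α (f j) x from funext fun x => mul_comm _ _, this]
    exact congrArg _ (funext fun x => by ring)
  · have := (h j α).integral_mul_iterOp_partialD hV hK hKV (hf j) α
    calc ∫ x in V, f j x * ((-1 : ℝ) ^ (∑ i, α i) * iterOp partialD α (g j α) x)
        = (-1 : ℝ) ^ (∑ i, α i) * ∫ x in V, f j x * iterOp partialD α (g j α) x := by
          rw [← MeasureTheory.integral_const_mul]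
          exact congrArg _ (funext fun x => by ring)
      _ = ∫ x in V, iterOp partialD α (f j) x * g j α x := by
          rw [this, ← MeasureTheory.integral_const_mul]
          exact congrArg _ (funext fun x => by rw [mul_assoc, ← mul_assoc, hsign, one_mul])

namespace IsSecOn

theorem eulerExpr_secJet (h : IsSecOn T V s) (hF : IsJetSmooth T r F) (σ : Fin m) (hξ : ξ ∈ V) :
    eulerExpr r F σ (secJet s ξ) = ∑ α ∈ multiIdx n r, (-1 : ℝ) ^ (∑ i, α i) *
      iterOp partialD α (fun ζ => jetPartialY σ α F (secJet s ζ)) ξ :=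
  Finset.sum_congr rfl fun α _ => congrArg _
    (h.totalDs_secJet (hF.jetPartialY h.isOpen_target σ α) α hξ)

/-- The first variation formula along a section. -/
theorem integral_first_variation (h : IsSecOn T V s) (hK : IsCompact K) (hKV : K ⊆ V)
    (hF : IsJetSmooth T r F) (hφ : ∀ σ, IsTestOn V K (fun ζ => φ ζ σ)) :
    ∫ x in V, ∑ σ, ∑ α ∈ multiIdx n r, iterOp partialD α (fun ζ => φ ζ σ) x *
        jetPartialY σ α F (secJet s x) =
      ∫ x in V, ∑ σ, φ x σ * eulerExpr r F σ (secJet s x) := by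
  have := integral_sum_adjoint (S := Finset.univ) (N := r) h.isOpen hK hKV
    (f := fun (σ : Fin m) ζ => φ ζ σ) (g := fun σ α ζ => jetPartialY σ α F (secJet s ζ))
    (fun σ => (hφ σ).contDiffOn)
    (fun σ α => h.contDiffOn_comp_secJet (hF.jetPartialY h.isOpen_target σ α)) (Or.inl hφ)
  rw [← this]
  exact MeasureTheory.setIntegral_congr_fun h.isOpen.measurableSet fun x hx =>
    Finset.sum_congr rfl fun σ _ => congrArg _ (h.eulerExpr_secJet hF σ hx).symm

/-- The second variation of a density, in terms of the linearized Euler–Lagrange expressions. -/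
theorem integral_mul_linearizeAt_eulerExpr (h : IsSecOn T V s) (hK : IsCompact K) (hKV : K ⊆ V)
    (hF : IsJetSmooth T r F) (hφ : ∀ σ, ContDiffOn ℝ ∞ (fun ζ => φ ζ σ) V)
    (hψ : ∀ σ, ContDiffOn ℝ ∞ (fun ζ => ψ ζ σ) V)
    (htest : (∀ σ, IsTestOn V K (fun ζ => φ ζ σ)) ∨ ∀ σ, IsTestOn V K (fun ζ => ψ ζ σ)) :
    ∫ x in V, ∑ σ, φ x σ * linearizeAt s ψ (eulerExpr r F σ) x =
      ∫ x in V, ∑ σ, ∑ α ∈ multiIdx n r, iterOp partialD α (fun ζ => φ ζ σ) x *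
        linearizeAt s ψ (jetPartialY σ α F) x := by
  have hFY := fun σ α => hF.jetPartialY h.isOpen_target σ α
  have := integral_sum_adjoint (S := Finset.univ) (N := r) h.isOpen hK hKV
    (f := fun (σ : Fin m) ζ => φ ζ σ) (g := fun σ α => linearizeAt s ψ (jetPartialY σ α F))
    hφ (fun σ α => h.contDiffOn_linearizeAt (hFY σ α) hψ)
    (htest.imp_right fun ht σ α => h.isTestOn_linearizeAt hK (hFY σ α) ht)
  rw [← this]
  exact MeasureTheory.setIntegral_congr_fun h.isOpen.measurableSet fun x hx =>
    Finset.sum_congr rfl fun σ _ => congrArg _ (h.linearizeAt_eulerExpr hF hψ σ hx)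

/-- The second variation of a density is symmetric, one of the variations having compact support. -/
theorem integral_mul_linearizeAt_eulerExpr_comm (h : IsSecOn T V s) (hK : IsCompact K)
    (hKV : K ⊆ V) (hF : IsJetSmooth T r F) (hφ : ∀ σ, IsTestOn V K (fun ζ => φ ζ σ))
    (hψ : ∀ σ, ContDiffOn ℝ ∞ (fun ζ => ψ ζ σ) V) :
    ∫ x in V, ∑ σ, φ x σ * linearizeAt s ψ (eulerExpr r F σ) x =
      ∫ x in V, ∑ σ, ψ x σ * linearizeAt s φ (eulerExpr r F σ) x := by
  have hφ' : ∀ σ, ContDiffOn ℝ ∞ (fun ζ => φ ζ σ) V := fun σ => (hφ σ).contDiffOn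
  rw [h.integral_mul_linearizeAt_eulerExpr hK hKV hF hφ' hψ (Or.inl hφ),
    h.integral_mul_linearizeAt_eulerExpr hK hKV hF hψ hφ' (Or.inr hφ)]
  exact MeasureTheory.setIntegral_congr_fun h.isOpen.measurableSet fun x hx =>
    h.sum_linearizeAt_jetPartialY_comm hF hx

/-- The linearized Euler–Lagrange expressions form a formally self-adjoint operator (the Helmholtz
conditions), here along an arbitrary section. -/
theorem linearizeAt_eulerExpr_eq_adjoint (h : IsSecOn T V s) (hF : IsJetSmooth T r F)
    {N : ℕ} (hN : r + r ≤ N) (hψ : ∀ σ, ContDiffOn ℝ ∞ (fun ζ => ψ ζ σ) V) (σ : Fin m)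
    (hξ : ξ ∈ V) :
    linearizeAt s ψ (eulerExpr r F σ) ξ =
      ∑ τ, ∑ α ∈ multiIdx n N, (-1 : ℝ) ^ (∑ i, α i) *
        iterOp partialD α
          (fun ζ => jetPartialY σ α (eulerExpr r F τ) (secJet s ζ) * ψ ζ τ) ξ := by
  have hT := h.isOpen_target
  have hE : ∀ τ, IsJetSmooth T N (eulerExpr r F τ) := fun τ => (hF.eulerExpr hT τ).mono hN
  have hA : ∀ τ σ α, ContDiffOn ℝ ∞
      (fun ζ => jetPartialY σ α (eulerExpr r F τ) (secJet s ζ) * ψ ζ τ) V := fun τ σ α =>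
    (h.contDiffOn_comp_secJet ((hE τ).jetPartialY hT σ α)).mul (hψ τ)
  have hadj : ∀ σ, ContDiffOn ℝ ∞ (fun ξ => ∑ τ, ∑ α ∈ multiIdx n N,
      (-1 : ℝ) ^ (∑ i, α i) * iterOp partialD α
        (fun ζ => jetPartialY σ α (eulerExpr r F τ) (secJet s ζ) * ψ ζ τ) ξ) V := fun σ =>
    ContDiffOn.sum fun τ _ => ContDiffOn.sum fun α _ =>
      contDiffOn_const.mul ((hA τ σ α).iterOp_partialD h.isOpen α)
  refine sub_eq_zero.1 (eqOn_zero_of_integral_test_mul h.isOpen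
    ((h.contDiffOn_linearizeAt (hE σ) hψ).sub (hadj σ)) (fun χ hχ hχc hχV => ?_) ξ hξ)
  -- the test variation with `σ`-component `χ` and all other components zero
  set φ : (Fin n → ℝ) → Fin m → ℝ := fun ζ => Pi.single σ (χ ζ) with hφdef
  have hχt : IsTestOn V (tsupport χ) χ := .of_tsupport_subset hχ
  have hφ : ∀ τ, IsTestOn V (tsupport χ) (fun ζ => φ ζ τ) := by
    intro τ
    by_cases hτ : τ = σ
    · subst hτ; simpa [hφdef] using hχt
    · exact ⟨by simpa [hφdef, hτ] using contDiffOn_const, fun _ _ _ => by simp [hφdef, hτ]⟩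
  have hsum : ∀ a : Fin m → ℝ, ∀ x, ∑ τ, φ x τ * a τ = χ x * a σ := fun a x => by
    rw [Finset.sum_eq_single σ] <;> simp +contextual [hφdef]
  have hsym := h.integral_mul_linearizeAt_eulerExpr_comm hχc hχV hF hφ hψ
  -- integrate by parts to move all derivatives from `φ` to the coefficients and `ψ`
  have hparts : ∫ x in V, ∑ τ, ψ x τ * linearizeAt s φ (eulerExpr r F τ) x =
      ∫ x in V, χ x * ∑ τ, ∑ α ∈ multiIdx n N, (-1 : ℝ) ^ (∑ i, α i) *
        iterOp partialD α
          (fun ζ => jetPartialY σ α (eulerExpr r F τ) (secJet s ζ) * ψ ζ τ) x := by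
    have := integral_sum_adjoint (S := Finset.univ) (N := N) h.isOpen hχc hχV
      (f := fun (j : Fin m × Fin m) ζ => φ ζ j.1)
      (g := fun j α ζ => jetPartialY j.1 α (eulerExpr r F j.2) (secJet s ζ) * ψ ζ j.2)
      (fun j => (hφ j.1).contDiffOn) (fun j α => hA j.2 j.1 α) (Or.inl fun j => hφ j.1)
    simp only [Fintype.sum_prod_type] at this
    calc _ = _ := MeasureTheory.setIntegral_congr_fun h.isOpen.measurableSet fun x hx => ?_
      _ = _ := this.symm
      _ = _ := MeasureTheory.setIntegral_congr_fun h.isOpen.measurableSet fun x hx => ?_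
    · simp only [h.linearizeAt_eq_sum (hE _) hx, Finset.mul_sum]
      rw [Finset.sum_comm]
      refine Finset.sum_congr rfl fun τ _ => Finset.sum_congr rfl fun ρ _ =>
        Finset.sum_congr rfl fun α _ => by ring
    · simp only [← Finset.mul_sum, hsum]
  rw [hparts] at hsym
  simp only [hsum] at hsym
  simp only [mul_sub]
  rw [MeasureTheory.integral_sub, hsym, sub_self]
  · exact (hχt.mul_right (h.contDiffOn_linearizeAt (hE σ) hψ)).integrableOn h.isOpen hχc hχV
  · exact (hχt.mul_right (hadj σ)).integrableOn h.isOpen hχc hχV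

end IsSecOn

end Variation

/-! ### Sections and vertical fields in fibered coordinates -/

section Fibered

variable {n m : ℕ} {X Y : Type*} [TopologicalSpace X] [ChartedSpace (Fin n → ℝ) X]
  [TopologicalSpace Y] [ChartedSpace ((Fin n → ℝ) × (Fin m → ℝ)) Y] {π : Y → X}

namespace FiberedChart

/-- The functions `y^σ ∘ γ` of the base coordinates. -/
def localRep (c : FiberedChart n m π) (γ : LocalSection n m π) : (Fin n → ℝ) → Fin m → ℝ :=
  fun ζ σ => (c.total (γ.toFun (c.base.symm ζ))).2 σ

theorem jet_eq_secJet (c : FiberedChart n m π) (γ : LocalSection n m π) (ξ : Fin n → ℝ) :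
    c.jet γ ξ = secJet (c.localRep γ) ξ := rfl

theorem region_subset (c : FiberedChart n m π) (γ : LocalSection n m π) :
    c.region γ ⊆ c.base.source := by
  rintro x ⟨hx, hx'⟩
  rw [← c.image_source]
  exact ⟨_, hx', γ.isSection x hx⟩

theorem isOpen_region (c : FiberedChart n m π) (γ : LocalSection n m π) :
    IsOpen (c.region γ) :=
  γ.smooth.continuousOn.isOpen_inter_preimage γ.dom.isOpen c.total.open_source

theorem total_section_fst (c : FiberedChart n m π) (γ : LocalSection n m π) {x : X}
    (hx : x ∈ c.region γ) : (c.total (γ.toFun x)).1 = c.base x := by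
  rw [← c.adapted _ hx.2, γ.isSection x hx.1]

theorem isSecOn (c : FiberedChart n m π) (γ : LocalSection n m π) :
    IsSecOn c.total.target (c.regionCoord γ) (c.localRep γ) where
  isOpen := c.base.isOpen_image_of_subset_source (c.isOpen_region γ) (c.region_subset γ)
  isOpen_target := c.total.open_target
  contDiffOn σ := by
    have hsub : c.regionCoord γ ⊆ c.base.target := by
      rintro _ ⟨x, hx, rfl⟩
      exact c.base.map_source (c.region_subset γ hx)
    have hmaps : Set.MapsTo c.base.symm (c.regionCoord γ) (c.region γ) := by
      rintro _ ⟨x, hx, rfl⟩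
      rwa [c.base.left_inv (c.region_subset γ hx)]
    have h1 := (contMDiffOn_symm_of_mem_maximalAtlas c.base_mem).mono hsub
    have h2 := γ.smooth.comp h1 fun ξ hξ => (hmaps hξ).1
    have h3 := (contMDiffOn_of_mem_maximalAtlas c.total_mem).comp h2 fun ξ hξ => (hmaps hξ).2
    have h4 := h3.contDiffOn
    exact contDiffOn_pi.1 h4.snd σ
  mem := by
    rintro _ ⟨x, hx, rfl⟩
    have : (c.base x, c.localRep γ (c.base x)) = c.total (γ.toFun x) := by
      refine Prod.ext (c.total_section_fst γ hx).symm ?_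
      funext σ
      simp only [localRep, c.base.left_inv (c.region_subset γ hx)]
    rw [this]
    exact c.total.map_source hx.2

theorem isJetSmooth_lagDensity (c : FiberedChart n m π) {r : ℕ} (lam : Lagrangian n m π r) :
    IsJetSmooth c.total.target r (fun z => c.lagDensity lam (z.trunc r)) :=
  ⟨c.lagDensity lam, (lam.smooth c).choose_spec.1, fun _ _ => rfl⟩

theorem isJetSmooth_lagEuler (c : FiberedChart n m π) {r : ℕ}
    (lam : Lagrangian n m π r) (ρ : Fin m) :
    IsJetSmooth c.total.target (2 * r + 1) (c.lagEuler lam ρ) :=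
  ((c.isJetSmooth_lagDensity lam).eulerExpr c.total.open_target ρ).mono (by omega)

theorem mdifferentiable_total (c : FiberedChart n m π) :
    c.total.MDifferentiable 𝓘(ℝ, (Fin n → ℝ) × (Fin m → ℝ)) 𝓘(ℝ, (Fin n → ℝ) × (Fin m → ℝ)) :=
  ⟨(contMDiffOn_of_mem_maximalAtlas c.total_mem).mdifferentiableOn (by simp),
    (contMDiffOn_symm_of_mem_maximalAtlas c.total_mem).mdifferentiableOn (by simp)⟩

variable [IsManifold 𝓘(ℝ, (Fin n → ℝ) × (Fin m → ℝ)) ∞ Y]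

/-- The components of a smooth vertical field are smooth functions of the coordinates
`(x^i, y^σ)`. -/
theorem isJetSmooth_comp (c : FiberedChart n m π) (Ξ : VerticalField n m π) (σ : Fin m) :
    IsJetSmooth c.total.target 0 (c.comp Ξ σ) := by
  have h1 : ContMDiffOn 𝓘(ℝ, (Fin n → ℝ) × (Fin m → ℝ))
      (𝓘(ℝ, (Fin n → ℝ) × (Fin m → ℝ))).tangent ∞
      (fun q => (⟨c.total.symm q, Ξ.toFun (c.total.symm q)⟩ :
        TangentBundle 𝓘(ℝ, (Fin n → ℝ) × (Fin m → ℝ)) Y)) c.total.target :=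
    Ξ.smooth.comp_contMDiffOn (contMDiffOn_symm_of_mem_maximalAtlas c.total_mem)
  have h2 := (contMDiffOn_of_mem_maximalAtlas c.total_mem).contMDiffOn_tangentMapWithin
    (m := ∞) (by simp) c.total.open_source.uniqueMDiffOn
  have h3 := (contMDiff_snd_tangentBundle_modelSpace ((Fin n → ℝ) × (Fin m → ℝ))
    𝓘(ℝ, (Fin n → ℝ) × (Fin m → ℝ)) (n := ∞)).comp_contMDiffOn
    (h2.comp h1 fun q hq => c.total.map_target hq)
  have h4 : ContDiffOn ℝ ∞ (fun q => (mfderiv 𝓘(ℝ, (Fin n → ℝ) × (Fin m → ℝ))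
      𝓘(ℝ, (Fin n → ℝ) × (Fin m → ℝ)) c.total (c.total.symm q) (Ξ.toFun (c.total.symm q)) :
        (Fin n → ℝ) × (Fin m → ℝ))) c.total.target := by
    refine h3.contDiffOn.congr fun q hq => ?_
    exact (congrArg (· (Ξ.toFun (c.total.symm q))) (mfderivWithin_of_isOpen
      (I := 𝓘(ℝ, (Fin n → ℝ) × (Fin m → ℝ))) (I' := 𝓘(ℝ, (Fin n → ℝ) × (Fin m → ℝ)))
      (f := c.total) c.total.open_source (c.total.map_target hq))).symm
  have hq : ContDiff ℝ ∞ (fun w : JetCoord n m 0 =>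
      (w.1, fun τ => w.2 τ ⟨0, zero_mem_multiIdx n 0⟩)) := by fun_prop
  have h5 := h4.comp hq.contDiffOn (s := jetCoordsOver c.total.target 0) fun w hw => hw
  exact ⟨_, contDiffOn_pi.1 h5.snd σ, fun _ _ => rfl⟩

/-- The coordinate field `∂/∂y^σ` times a function of the coordinates with compact support, extended
by zero, is a vertical vector field on `Y`. -/
theorem exists_verticalField (c : FiberedChart n m π) [T2Space Y]
    (hπ : ContMDiff 𝓘(ℝ, (Fin n → ℝ) × (Fin m → ℝ)) 𝓘(ℝ, Fin n → ℝ) ∞ π)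
    {h : (Fin n → ℝ) × (Fin m → ℝ) → ℝ} (hh : ContDiff ℝ ∞ h)
    {C : Set ((Fin n → ℝ) × (Fin m → ℝ))} (hC : IsCompact C) (hCT : C ⊆ c.total.target)
    (h0 : ∀ q ∉ C, h q = 0) (σ : Fin m) :
    ∃ Ξ : VerticalField n m π,
      (∀ p ∈ c.total.source, mfderiv 𝓘(ℝ, (Fin n → ℝ) × (Fin m → ℝ))
        𝓘(ℝ, (Fin n → ℝ) × (Fin m → ℝ)) c.total p (Ξ.toFun p) =
          ((0, h (c.total p) • Pi.single σ 1) : (Fin n → ℝ) × (Fin m → ℝ))) ∧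
      (∀ p ∈ c.total.source, h (c.total p) = 0 → Ξ.toFun p = 0) ∧
      ∀ p ∉ c.total.source, Ξ.toFun p = 0 := by
  classical
  let e : (Fin n → ℝ) × (Fin m → ℝ) := (0, Pi.single σ 1)
  let ψ : Y → ℝ := fun p => if p ∈ c.total.source then h (c.total p) else 0
  let V : ∀ q : (Fin n → ℝ) × (Fin m → ℝ), TangentSpace 𝓘(ℝ, (Fin n → ℝ) × (Fin m → ℝ)) q :=
    fun _ => e
  let S : ∀ p : Y, TangentSpace 𝓘(ℝ, (Fin n → ℝ) × (Fin m → ℝ)) p :=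
    VectorField.mpullback 𝓘(ℝ, (Fin n → ℝ) × (Fin m → ℝ)) 𝓘(ℝ, (Fin n → ℝ) × (Fin m → ℝ))
      c.total V
  have hinv : ∀ p ∈ c.total.source, (mfderiv 𝓘(ℝ, (Fin n → ℝ) × (Fin m → ℝ))
      𝓘(ℝ, (Fin n → ℝ) × (Fin m → ℝ)) c.total p).IsInvertible := fun p hp =>
    ⟨c.mdifferentiable_total.mfderiv hp, rfl⟩
  have hS : ∀ p ∈ c.total.source, mfderiv 𝓘(ℝ, (Fin n → ℝ) × (Fin m → ℝ))
      𝓘(ℝ, (Fin n → ℝ) × (Fin m → ℝ)) c.total p (S p) = e := by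
    intro p hp
    exact (hinv p hp).self_apply_inverse e
  have hψ : ∀ p ∈ c.total.source, ψ p = h (c.total p) := fun p hp => if_pos hp
  have hψ0 : ∀ p ∉ c.total.source, ψ p = 0 := fun p hp => if_neg hp
  have hψs : ContMDiffOn 𝓘(ℝ, (Fin n → ℝ) × (Fin m → ℝ)) 𝓘(ℝ, ℝ) ∞ ψ c.total.source :=
    (hh.contMDiff.comp_contMDiffOn (contMDiffOn_of_mem_maximalAtlas c.total_mem)).congr hψ
  have hclosed : IsClosed (c.total.symm '' C) :=
    (hC.image_of_continuousOn (c.total.continuousOn_symm.mono hCT)).isClosed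
  have hts : tsupport ψ ⊆ c.total.source := by
    have h1 : tsupport ψ ⊆ c.total.symm '' C := by
      refine closure_minimal (fun p hp => ?_) hclosed
      by_cases hps : p ∈ c.total.source
      · refine ⟨c.total p, ?_, c.total.left_inv hps⟩
        by_contra hC'
        exact hp (by rw [hψ p hps, h0 _ hC'])
      · exact absurd (hψ0 p hps) hp
    refine h1.trans ?_
    rintro _ ⟨q, hq, rfl⟩
    exact c.total.map_target (hCT hq)
  have hVs : ContMDiff 𝓘(ℝ, (Fin n → ℝ) × (Fin m → ℝ))
      (𝓘(ℝ, (Fin n → ℝ) × (Fin m → ℝ))).tangent ∞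
      (fun q => (⟨q, V q⟩ :
        TangentBundle 𝓘(ℝ, (Fin n → ℝ) × (Fin m → ℝ)) ((Fin n → ℝ) × (Fin m → ℝ)))) := by
    refine contMDiff_vectorSpace_iff_contDiff.2 ?_
    exact contDiff_const (c := e)
  have hSs : ContMDiffOn 𝓘(ℝ, (Fin n → ℝ) × (Fin m → ℝ))
      (𝓘(ℝ, (Fin n → ℝ) × (Fin m → ℝ))).tangent ∞
      (fun p => (⟨p, S p⟩ : TangentBundle 𝓘(ℝ, (Fin n → ℝ) × (Fin m → ℝ)) Y))
      c.total.source := fun p hp =>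
    (ContMDiffAt.mpullback_vectorField_preimage hVs.contMDiffAt
      (contMDiffAt_of_mem_maximalAtlas c.total_mem hp) (hinv p hp)
      (by simp)).contMDiffWithinAt
  have hvert : ∀ p ∈ c.total.source,
      mfderiv 𝓘(ℝ, (Fin n → ℝ) × (Fin m → ℝ)) 𝓘(ℝ, Fin n → ℝ) π p (S p) = 0 := by
    intro p hp
    have hb : c.base.MDifferentiable 𝓘(ℝ, Fin n → ℝ) 𝓘(ℝ, Fin n → ℝ) :=
      ⟨(contMDiffOn_of_mem_maximalAtlas c.base_mem).mdifferentiableOn (by simp),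
        (contMDiffOn_symm_of_mem_maximalAtlas c.base_mem).mdifferentiableOn (by simp)⟩
    have hpb : π p ∈ c.base.source := c.image_source ▸ ⟨p, hp, rfl⟩
    refine hb.mfderiv_injective hpb ?_
    rw [map_zero]
    have h1 := mfderiv_comp_apply p (hb.mdifferentiableAt hpb)
      ((hπ p).mdifferentiableAt (by simp)) (S p)
    have heq : c.base ∘ π =ᶠ[nhds p] Prod.fst ∘ c.total := by
      filter_upwards [c.total.open_source.mem_nhds hp] with p' hp' using c.adapted p' hp'
    have hfst : MDifferentiableAt 𝓘(ℝ, (Fin n → ℝ) × (Fin m → ℝ)) 𝓘(ℝ, Fin n → ℝ)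
        (Prod.fst : (Fin n → ℝ) × (Fin m → ℝ) → (Fin n → ℝ)) (c.total p) :=
      differentiableAt_fst.mdifferentiableAt
    have h2 := mfderiv_comp_apply p hfst (c.mdifferentiable_total.mdifferentiableAt hp) (S p)
    have h3 : mfderiv 𝓘(ℝ, (Fin n → ℝ) × (Fin m → ℝ)) 𝓘(ℝ, Fin n → ℝ)
        (Prod.fst : (Fin n → ℝ) × (Fin m → ℝ) → (Fin n → ℝ)) (c.total p) e = 0 := by
      rw [mfderiv_eq_fderiv, fderiv_fst]
      rfl
    have h4 : mfderiv 𝓘(ℝ, (Fin n → ℝ) × (Fin m → ℝ)) 𝓘(ℝ, Fin n → ℝ) (c.base ∘ π) p (S p) =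
        mfderiv 𝓘(ℝ, (Fin n → ℝ) × (Fin m → ℝ)) 𝓘(ℝ, Fin n → ℝ) (Prod.fst ∘ c.total) p (S p) :=
      congrArg (fun L : ((Fin n → ℝ) × (Fin m → ℝ)) →L[ℝ] (Fin n → ℝ) => L (S p)) heq.mfderiv_eq
    exact h1.symm.trans (h4.trans (h2.trans ((congrArg _ (hS p hp)).trans h3)))
  refine ⟨⟨ψ • S, ContMDiffOn.smul_section_of_tsupport hψs c.total.open_source hts hSs,
    fun p => ?_⟩, fun p hp => ?_, fun p hp hp0 => ?_, fun p hp => ?_⟩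
  · by_cases hp : p ∈ c.total.source
    · rw [Pi.smul_apply', map_smul, hvert p hp, smul_zero]
    · rw [Pi.smul_apply', hψ0 p hp, zero_smul, map_zero]
  · change mfderiv _ _ c.total p (ψ p • S p) = _
    rw [map_smul, hS p hp, hψ p hp]
    exact Prod.ext (smul_zero _) rfl
  · change ψ p • S p = 0
    rw [hψ p hp, hp0, zero_smul]
  · change ψ p • S p = 0
    rw [hψ0 p hp, zero_smul]

end FiberedChart

end Fibered

/-! ### The Euler–Lagrange equations along a critical section -/

section Critical

variable {n m r : ℕ} {X Y : Type*} [TopologicalSpace X] [ChartedSpace (Fin n → ℝ) X]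
  [TopologicalSpace Y] [ChartedSpace ((Fin n → ℝ) × (Fin m → ℝ)) Y] {π : Y → X}
  [IsManifold 𝓘(ℝ, (Fin n → ℝ) × (Fin m → ℝ)) ∞ Y]

/-- The components of a vertical field along `γ`, as functions of the base coordinates. -/
noncomputable def FiberedChart.compAlong (c : FiberedChart n m π) (γ : LocalSection n m π)
    (Ξ : VerticalField n m π) : (Fin n → ℝ) → Fin m → ℝ :=
  fun ζ σ => c.comp Ξ σ (c.jet γ ζ)

namespace FiberedChart

variable (c : FiberedChart n m π) (γ : LocalSection n m π) (Ξ : VerticalField n m π)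

theorem compAlong_base {x : X} (hx : x ∈ c.region γ) :
    c.compAlong γ Ξ (c.base x) = (mfderiv 𝓘(ℝ, (Fin n → ℝ) × (Fin m → ℝ))
      𝓘(ℝ, (Fin n → ℝ) × (Fin m → ℝ)) c.total (γ.toFun x) (Ξ.toFun (γ.toFun x))).2 := by
  have h : c.total.symm ((c.jet γ (c.base x)).1, fun τ => (c.jet γ (c.base x)).2 τ 0) =
      γ.toFun x := by
    have : ((c.jet γ (c.base x)).1, fun τ => (c.jet γ (c.base x)).2 τ 0) =
        c.total (γ.toFun x) := by
      refine Prod.ext (c.total_section_fst γ hx).symm ?_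
      funext τ
      simp only [jet, iterOp_zero, c.base.left_inv (c.region_subset γ hx)]
    rw [this, c.total.left_inv hx.2]
  funext σ
  simp only [compAlong, comp]
  rw [h]

theorem contDiffOn_compAlong (σ : Fin m) :
    ContDiffOn ℝ ∞ (fun ζ => c.compAlong γ Ξ ζ σ) (c.regionCoord γ) :=
  (c.isSecOn γ).contDiffOn_comp_secJet (c.isJetSmooth_comp Ξ σ)

theorem totalDs_comp_jet (σ : Fin m) (α : Fin n → ℕ) {ξ : Fin n → ℝ}
    (hξ : ξ ∈ c.regionCoord γ) :
    totalDs α (c.comp Ξ σ) (c.jet γ ξ) =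
      iterOp partialD α (fun ζ => c.compAlong γ Ξ ζ σ) ξ :=
  (c.isSecOn γ).totalDs_secJet (c.isJetSmooth_comp Ξ σ) α hξ

variable {Ξ} in
/-- A vertical field with compact support along `γ` has test functions as components. -/
theorem CompactAlong.exists_isTestOn {c : FiberedChart n m π} {γ : LocalSection n m π}
    (h : c.CompactAlong γ Ξ) : ∃ K, IsCompact K ∧ K ⊆ c.regionCoord γ ∧
      ∀ σ, IsTestOn (c.regionCoord γ) K (fun ζ => c.compAlong γ Ξ ζ σ) := by
  obtain ⟨K, hK, hKr, h0⟩ := h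
  refine ⟨c.base '' K, hK.image_of_continuousOn
    (c.base.continuousOn.mono (hKr.trans (c.region_subset γ))), Set.image_mono hKr,
    fun σ => ⟨c.contDiffOn_compAlong γ Ξ σ, ?_⟩⟩
  rintro _ ⟨x, hx, rfl⟩ hxK
  have hx0 : Ξ.toFun (γ.toFun x) = 0 := h0 x hx.1 fun h => hxK ⟨x, h, rfl⟩
  rw [c.compAlong_base γ Ξ hx, hx0, map_zero]
  rfl

/-- Every test function on the coordinate region of `γ` is the `σ`-component of a vertical field on
`Y` with compact support along `γ`, the other components being zero. -/
theorem exists_compactAlong [T2Space Y]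
    (hπ : ContMDiff 𝓘(ℝ, (Fin n → ℝ) × (Fin m → ℝ)) 𝓘(ℝ, Fin n → ℝ) ∞ π)
    {φ : (Fin n → ℝ) → ℝ} (hφ : ContDiff ℝ ∞ φ) (hφc : HasCompactSupport φ)
    (hφV : tsupport φ ⊆ c.regionCoord γ) (σ : Fin m) :
    ∃ Ξ : VerticalField n m π, c.CompactAlong γ Ξ ∧
      ∀ ξ ∈ c.regionCoord γ, c.compAlong γ Ξ ξ = Pi.single σ (φ ξ) := by
  have hsec := c.isSecOn γ
  have hcont : ContinuousOn (fun ξ => (ξ, c.localRep γ ξ)) (c.regionCoord γ) :=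
    continuousOn_id.prodMk (continuousOn_pi.2 fun σ => (hsec.contDiffOn σ).continuousOn)
  -- cut off near the image of the support of `φ` under the section
  set C₀ := (fun ξ => (ξ, c.localRep γ ξ)) '' tsupport φ with hC₀
  have hC₀c : IsCompact C₀ := hφc.image_of_continuousOn (hcont.mono hφV)
  have hC₀T : C₀ ⊆ c.total.target := by
    rintro _ ⟨ξ, hξ, rfl⟩
    exact hsec.mem ξ (hφV hξ)
  obtain ⟨C, hC, hCi, hCT⟩ := exists_compact_between hC₀c c.total.open_target hC₀T
  obtain ⟨g, hg1, hg0, -⟩ := exists_contMDiffMap_one_nhds_of_subset_interior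
    𝓘(ℝ, (Fin n → ℝ) × (Fin m → ℝ)) (n := ⊤) hC₀c.isClosed hCi
  have hg : ContDiff ℝ ∞ g := g.contMDiff.contDiff
  set h : (Fin n → ℝ) × (Fin m → ℝ) → ℝ := fun q => φ q.1 * g q with hh
  obtain ⟨Ξ, hΞ, hΞ0, hΞs⟩ := c.exists_verticalField hπ (h := h)
    ((hφ.comp contDiff_fst).mul hg) hC hCT (fun q hq => by simp [hh, hg0 q hq]) σ
  have hval : ∀ ξ, h (ξ, c.localRep γ ξ) = φ ξ := by
    intro ξ
    by_cases hξ : ξ ∈ tsupport φ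
    · have : g (ξ, c.localRep γ ξ) = 1 := hg1.self_of_nhdsSet _ ⟨ξ, hξ, rfl⟩
      simp [hh, this]
    · simp [hh, image_eq_zero_of_notMem_tsupport hξ]
  refine ⟨Ξ, ⟨c.base.symm '' tsupport φ, ?_, ?_, ?_⟩, ?_⟩
  · refine hφc.image_of_continuousOn (c.base.continuousOn_symm.mono (hφV.trans ?_))
    rintro _ ⟨x, hx, rfl⟩
    exact c.base.map_source (c.region_subset γ hx)
  · rintro _ ⟨ξ, hξ, rfl⟩
    obtain ⟨x, hx, rfl⟩ := hφV hξ
    rwa [c.base.left_inv (c.region_subset γ hx)]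
  · intro x hx hxK
    by_cases hxs : γ.toFun x ∈ c.total.source
    · have hxr : x ∈ c.region γ := ⟨hx, hxs⟩
      refine hΞ0 _ hxs ?_
      have : c.base x ∉ tsupport φ := fun h' =>
        hxK ⟨c.base x, h', c.base.left_inv (c.region_subset γ hxr)⟩
      simp [hh, c.total_section_fst γ hxr, image_eq_zero_of_notMem_tsupport this]
    · exact hΞs _ hxs
  · rintro _ ⟨x, hx, rfl⟩
    have hq : c.total (γ.toFun x) = (c.base x, c.localRep γ (c.base x)) := by
      refine Prod.ext (c.total_section_fst γ hx) ?_
      funext τ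
      simp only [localRep, c.base.left_inv (c.region_subset γ hx)]
    rw [c.compAlong_base γ Ξ hx, hΞ _ hx.2, hq, hval]
    funext τ
    by_cases hτ : τ = σ
    · subst hτ; simp
    · simp [hτ]

end FiberedChart

/-- The Euler–Lagrange equations hold along a critical section. -/
theorem Lagrangian.IsCritical.lagEuler_jet_eq_zero [T2Space Y]
    (hπ : ContMDiff 𝓘(ℝ, (Fin n → ℝ) × (Fin m → ℝ)) 𝓘(ℝ, Fin n → ℝ) ∞ π)
    {lam : Lagrangian n m π r} {γ : LocalSection n m π} (hγ : lam.IsCritical γ)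
    (c : FiberedChart n m π) (σ : Fin m) {ξ : Fin n → ℝ} (hξ : ξ ∈ c.regionCoord γ) :
    c.lagEuler lam σ (c.jet γ ξ) = 0 := by
  have hsec := c.isSecOn γ
  have hF := c.isJetSmooth_lagDensity lam
  refine eqOn_zero_of_integral_test_mul hsec.isOpen
    (hsec.contDiffOn_comp_secJet (hF.eulerExpr hsec.isOpen_target σ))
    (fun φ hφ hφc hφV => ?_) ξ hξ
  obtain ⟨Ξ, hΞ, hcomp⟩ := c.exists_compactAlong γ hπ hφ hφc hφV σ
  obtain ⟨K, hK, hKV, htest⟩ := hΞ.exists_isTestOn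
  rw [← hγ c Ξ hΞ]
  calc _ = _ := MeasureTheory.setIntegral_congr_fun hsec.isOpen.measurableSet fun x hx => ?_
    _ = _ := (hsec.integral_first_variation hK hKV hF htest).symm
    _ = _ := MeasureTheory.setIntegral_congr_fun hsec.isOpen.measurableSet fun x hx => ?_
  · simp only [hcomp x hx]
    rw [Finset.sum_eq_single σ] <;> simp +contextual
  · exact Finset.sum_congr rfl fun τ _ => Finset.sum_congr rfl fun α _ =>
      congrArg (· * _) (c.totalDs_comp_jet γ Ξ τ α hx).symm

end Critical

/-! ### Coordinate expressions of the Jacobi morphism -/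

section Jacobi

variable {n m r : ℕ}

theorem density_smul_baseVol (a : ℝ) : density (a • baseVol n m) = a := by
  have : (fun i : Fin n => (Pi.single i 1 : Fin n → ℝ)) = (1 : Matrix (Fin n) (Fin n) ℝ) := by
    funext i j
    simp [Matrix.one_apply, Pi.single_apply, eq_comm]
  have h : baseVol n m (fun i => (Pi.single i 1, 0)) = 1 := by
    change Matrix.det (fun i : Fin n => (Pi.single i 1 : Fin n → ℝ)) = 1
    rw [this, Matrix.det_one]
  simp [density, h]

/-- `v ⌋ (ω^σ ∧ ds) = v^σ ds` for a vertical vector `v`. -/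
theorem density_curryLeft_contactVol (z : JetPt n m) (σ : Fin m)
    (w : Fin m → (Fin n → ℕ) → ℝ) :
    density ((contactVol z σ).curryLeft (0, w)) = w σ 0 := by
  have h1 : density (baseVol n m) = 1 := by simpa using density_smul_baseVol (m := m) (n := n) 1
  rw [density, AlternatingMap.curryLeft_apply_apply, contactVol,
    AlternatingMap.alternatizeUncurryFin_apply, Fin.sum_univ_succ]
  rw [Finset.sum_eq_zero, add_zero]
  · simpa [contactForm, density] using congrArg (w σ 0 * ·) h1
  · -- the other terms contain the value of `ds` on a tuple with the vertical vector
    intro i _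
    have hn : 0 < n := Fin.pos i
    obtain ⟨n, rfl⟩ : ∃ k, n = k + 1 := ⟨n - 1, by omega⟩
    have : baseVol (n + 1) m (Fin.removeNth i.succ
        (Matrix.vecCons (0, w) fun i => (Pi.single i 1, 0))) = 0 := by
      change Matrix.det (fun j => (Fin.removeNth i.succ
        (Matrix.vecCons ((0, w) : JetPt (n + 1) m) fun i => (Pi.single i 1, 0)) j).1) = 0
      refine Matrix.det_eq_zero_of_row_eq_zero 0 fun j => ?_
      simp [Fin.removeNth]
    simp [this]

theorem iterOp_partialD_sum {ι : Type*} {S : Finset ι} {V : Set (Fin n → ℝ)}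
    {f : ι → (Fin n → ℝ) → ℝ} (hV : IsOpen V) (hf : ∀ j ∈ S, ContDiffOn ℝ ∞ (f j) V)
    (α : Fin n → ℕ) :
    Set.EqOn (iterOp partialD α fun x => ∑ j ∈ S, f j x)
      (fun x => ∑ j ∈ S, iterOp partialD α (f j) x) V := by
  induction α using multiIdx_induction with
  | zero => intro x _; simp
  | add_single α i ih =>
    intro x hx
    rw [iterOp_partialD_add_single hV (ContDiffOn.sum hf) α i hx, partialD_congr hV ih i hx,
      partialD, fderiv_fun_sum fun j hj =>
        ((hf j hj).iterOp_partialD hV α).differentiableAt_of_isOpen hV hx]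
    simp only [sum_apply]
    exact Finset.sum_congr rfl fun j hj =>
      (iterOp_partialD_add_single hV (hf j hj) α i hx).symm

variable {X Y : Type*} [TopologicalSpace X] [ChartedSpace (Fin n → ℝ) X]
  [TopologicalSpace Y] [ChartedSpace ((Fin n → ℝ) × (Fin m → ℝ)) Y] {π : Y → X}
  [IsManifold 𝓘(ℝ, (Fin n → ℝ) × (Fin m → ℝ)) ∞ Y]

namespace FiberedChart

variable (c : FiberedChart n m π) (lam : Lagrangian n m π r) (Ξ : VerticalField n m π)

/-- `Ξ ⌋ (a_σ ω^σ ∧ ds) = Ξ^σ a_σ ds`. -/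
theorem density_contract_eq {η : JetPt n m → JetForm n m (n + 1)} {z : JetPt n m}
    {a : Fin m → ℝ} (h : η z = ∑ σ, a σ • contactVol z σ) :
    density (c.contract Ξ η z) = ∑ σ, c.comp Ξ σ z * a σ := by
  have hd : ∀ σ, contactVol z σ (Matrix.vecCons (c.prolong Ξ z)
      fun i => (Pi.single i 1, 0)) = c.comp Ξ σ z := by
    intro σ
    have := density_curryLeft_contactVol z σ (c.prolong Ξ z).2
    simp only [density, AlternatingMap.curryLeft_apply_apply] at this
    refine this.trans ?_
    simp [prolong, totalDs]
  rw [density, contract, AlternatingMap.curryLeft_apply_apply, h]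
  let ev : JetForm n m (n + 1) →+ ℝ :=
    { toFun := fun f => f (Matrix.vecCons (c.prolong Ξ z) fun i => (Pi.single i 1, 0))
      map_zero' := rfl
      map_add' := fun _ _ => rfl }
  refine (map_sum ev _ _).trans (Finset.sum_congr rfl fun σ _ => ?_)
  change a σ * contactVol z σ _ = _
  rw [hd, mul_comm]

theorem jacobi_eq (z : JetPt n m) :
    c.jacobi lam Ξ z = ∑ σ, eulerExpr (2 * r + 1)
      (fun w => ∑ ρ, c.comp Ξ ρ w * c.lagEuler lam ρ w) σ z • contactVol z σ := by
  have h1 : (fun w => density (c.lagForm lam w)) = fun w => c.lagDensity lam (w.trunc r) :=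
    funext fun w => density_smul_baseVol _
  have h2 : (fun w => density (c.contract Ξ (eulerForm r (c.lagForm lam)) w)) =
      fun w => ∑ ρ, c.comp Ξ ρ w * c.lagEuler lam ρ w := by
    funext w
    refine c.density_contract_eq Ξ ?_
    simp only [eulerForm, h1, lagEuler]
  simp only [jacobi, eulerForm] at h2 ⊢
  simp only [h2]

variable (γ : LocalSection n m π) {ξ : Fin n → ℝ}

/-- The components of the Jacobi morphism along a solution of the Euler–Lagrange equations: the terms
in which `Ξ^ρ` is differentiated with respect to `y^σ` drop out. -/
theorem eulerExpr_contract_jet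
    (hE : ∀ ρ, ∀ ξ ∈ c.regionCoord γ, c.lagEuler lam ρ (c.jet γ ξ) = 0) (σ : Fin m)
    (hξ : ξ ∈ c.regionCoord γ) :
    eulerExpr (2 * r + 1) (fun w => ∑ ρ, c.comp Ξ ρ w * c.lagEuler lam ρ w) σ (c.jet γ ξ) =
      ∑ ρ, ∑ α ∈ multiIdx n (2 * r + 1), (-1 : ℝ) ^ (∑ i, α i) *
        totalDs α (fun z => c.comp Ξ ρ z * jetPartialY σ α (c.lagEuler lam ρ) z) (c.jet γ ξ) := by
  have hT := c.total.open_target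
  have hsec := c.isSecOn γ
  have hΞ : ∀ ρ, IsJetSmooth c.total.target (2 * r + 1) (c.comp Ξ ρ) := fun ρ =>
    (c.isJetSmooth_comp Ξ ρ).mono (Nat.zero_le _)
  have hL := c.isJetSmooth_lagEuler lam
  have hterm : ∀ ρ α, IsJetSmooth c.total.target (2 * r + 1)
      (fun z => c.comp Ξ ρ z * jetPartialY σ α (c.lagEuler lam ρ) z) := fun ρ α =>
    (hΞ ρ).mul ((hL ρ).jetPartialY hT σ α)
  rw [jet_eq_secJet, hsec.eulerExpr_secJet
    (IsJetSmooth.sum fun ρ _ => (hΞ ρ).mul (hL ρ)) σ hξ, Finset.sum_comm]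
  refine Finset.sum_congr rfl fun α _ => ?_
  rw [← Finset.mul_sum]
  congr 1
  have hcongr : Set.EqOn
      (fun ζ => jetPartialY σ α (fun w => ∑ ρ, c.comp Ξ ρ w * c.lagEuler lam ρ w)
        (secJet (c.localRep γ) ζ))
      (fun ζ => ∑ ρ, c.comp Ξ ρ (secJet (c.localRep γ) ζ) *
        jetPartialY σ α (c.lagEuler lam ρ) (secJet (c.localRep γ) ζ)) (c.regionCoord γ) := by
    intro ζ hζ
    have hz := hsec.secJet_mem hζ
    simp only [jetPartialY_sum hT (fun ρ _ => (hΞ ρ).mul (hL ρ)) hz σ α]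
    refine Finset.sum_congr rfl fun ρ _ => ?_
    rw [jetPartialY_mul hT (hΞ ρ) (hL ρ) hz, ← jet_eq_secJet, hE ρ ζ hζ, mul_zero, zero_add]
  rw [iterOp_partialD_congr hsec.isOpen hcongr α hξ, iterOp_partialD_sum hsec.isOpen
    (fun ρ _ => hsec.contDiffOn_comp_secJet (hterm ρ α)) α hξ]
  exact Finset.sum_congr rfl fun ρ _ => (hsec.totalDs_secJet (hterm ρ α) α hξ).symm

theorem linearizeAt_lagEuler (ρ : Fin m) (hξ : ξ ∈ c.regionCoord γ) :
    linearizeAt (c.localRep γ) (c.compAlong γ Ξ) (c.lagEuler lam ρ) ξ =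
      ∑ σ, ∑ α ∈ multiIdx n (2 * r + 1),
        totalDs α (c.comp Ξ σ) (c.jet γ ξ) * jetPartialY σ α (c.lagEuler lam ρ) (c.jet γ ξ) := by
  rw [(c.isSecOn γ).linearizeAt_eq_sum (c.isJetSmooth_lagEuler lam ρ) hξ]
  exact Finset.sum_congr rfl fun σ _ => Finset.sum_congr rfl fun α _ =>
    congrArg (· * _) (c.totalDs_comp_jet γ Ξ σ α hξ).symm

/-- Self-adjointness of the linearized Euler–Lagrange expressions, in the jet coordinates. -/
theorem linearizeAt_lagEuler_eq_adjoint (σ : Fin m) (hξ : ξ ∈ c.regionCoord γ) :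
    linearizeAt (c.localRep γ) (c.compAlong γ Ξ) (c.lagEuler lam σ) ξ =
      ∑ ρ, ∑ α ∈ multiIdx n (2 * r + 1), (-1 : ℝ) ^ (∑ i, α i) *
        totalDs α (fun z => c.comp Ξ ρ z * jetPartialY σ α (c.lagEuler lam ρ) z) (c.jet γ ξ) := by
  have hsec := c.isSecOn γ
  refine (hsec.linearizeAt_eulerExpr_eq_adjoint (c.isJetSmooth_lagDensity lam) (N := 2 * r + 1)
    (by omega) (c.contDiffOn_compAlong γ Ξ) σ hξ).trans ?_
  refine Finset.sum_congr rfl fun ρ _ => Finset.sum_congr rfl fun α _ => congrArg _ ?_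
  have hterm : IsJetSmooth c.total.target (2 * r + 1)
      (fun z => c.comp Ξ ρ z * jetPartialY σ α (c.lagEuler lam ρ) z) :=
    ((c.isJetSmooth_comp Ξ ρ).mono (Nat.zero_le _)).mul
      ((c.isJetSmooth_lagEuler lam ρ).jetPartialY c.total.open_target σ α)
  refine Eq.trans ?_ (hsec.totalDs_secJet hterm α hξ).symm
  exact congrArg (fun f => iterOp partialD α f ξ) (funext fun ζ => mul_comm _ _)

end FiberedChart

end Jacobi

theorem mainTheorem5 {n m : ℕ} {X Y : Type*}
    [TopologicalSpace X] [T2Space X] [SecondCountableTopology X] [ChartedSpace (Fin n → ℝ) X]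
    [IsManifold 𝓘(ℝ, Fin n → ℝ) ∞ X]
    [TopologicalSpace Y] [T2Space Y] [SecondCountableTopology Y]
    [ChartedSpace ((Fin n → ℝ) × (Fin m → ℝ)) Y]
    [IsManifold 𝓘(ℝ, (Fin n → ℝ) × (Fin m → ℝ)) ∞ Y]
    (π : Y → X) (hπ : IsFibered n m π) (r : ℕ) (lam : Lagrangian n m π r)
    (γ : LocalSection n m π) (hγ : lam.IsCritical γ) (c : FiberedChart n m π) :
    -- the first coordinate expression of the Jacobi morphism along the critical section
    (∀ (Ξ : VerticalField n m π), ∀ ξ ∈ c.regionCoord γ,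
      c.jacobi lam Ξ (c.jet γ ξ) =
        ∑ σ, (∑ ρ, ∑ α ∈ multiIdx n (2 * r + 1), (-1 : ℝ) ^ (∑ i, α i) *
          totalDs α (fun z => c.comp Ξ ρ z * jetPartialY σ α (c.lagEuler lam ρ) z) (c.jet γ ξ)) •
            contactVol (c.jet γ ξ) σ) ∧
    -- the second coordinate expression
    (∀ (Ξ : VerticalField n m π), ∀ ξ ∈ c.regionCoord γ,
      c.jacobi lam Ξ (c.jet γ ξ) =
        ∑ ρ, (∑ σ, ∑ α ∈ multiIdx n (2 * r + 1),
          totalDs α (c.comp Ξ σ) (c.jet γ ξ) * jetPartialY σ α (c.lagEuler lam ρ) (c.jet γ ξ)) •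
            contactVol (c.jet γ ξ) ρ) ∧
    -- the Jacobi morphism, a linear differential operator, coincides with its adjoint
    (∀ (Ξ : VerticalField n m π), ∀ ξ ∈ c.regionCoord γ,
      c.jacobi lam Ξ (c.jet γ ξ) = c.nabla (2 * r + 1) (c.jacobiCoeff lam) Ξ (c.jet γ ξ) ∧
      c.nabla (2 * r + 1) (c.jacobiCoeff lam) Ξ (c.jet γ ξ) =
        c.nablaStar (2 * r + 1) (c.jacobiCoeff lam) Ξ (c.jet γ ξ)) ∧
    -- and it is symmetric for the integral pairing with compactly supported fields
    (∀ Ξ₁ Ξ₂ : VerticalField n m π, c.CompactAlong γ Ξ₁ →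
      ∫ ξ in c.regionCoord γ, density (c.contract Ξ₂ (c.jacobi lam Ξ₁) (c.jet γ ξ)) =
        ∫ ξ in c.regionCoord γ, density (c.contract Ξ₁ (c.jacobi lam Ξ₂) (c.jet γ ξ))) := by

  have hE : ∀ ρ, ∀ ξ ∈ c.regionCoord γ, c.lagEuler lam ρ (c.jet γ ξ) = 0 := fun ρ ξ hξ =>
    hγ.lagEuler_jet_eq_zero hπ.smooth c ρ hξ
  have h1 : ∀ (Ξ : VerticalField n m π), ∀ ξ ∈ c.regionCoord γ, c.jacobi lam Ξ (c.jet γ ξ) =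
      ∑ σ, (∑ ρ, ∑ α ∈ multiIdx n (2 * r + 1), (-1 : ℝ) ^ (∑ i, α i) *
        totalDs α (fun z => c.comp Ξ ρ z * jetPartialY σ α (c.lagEuler lam ρ) z) (c.jet γ ξ)) •
          contactVol (c.jet γ ξ) σ := fun Ξ ξ hξ => by
    rw [c.jacobi_eq]
    exact Finset.sum_congr rfl fun σ _ => by rw [c.eulerExpr_contract_jet lam Ξ γ hE σ hξ]
  have hlin : ∀ (Ξ : VerticalField n m π), ∀ ξ ∈ c.regionCoord γ, c.jacobi lam Ξ (c.jet γ ξ) =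
      ∑ σ, linearizeAt (c.localRep γ) (c.compAlong γ Ξ) (c.lagEuler lam σ) ξ •
        contactVol (c.jet γ ξ) σ := fun Ξ ξ hξ => by
    rw [h1 Ξ ξ hξ]
    exact Finset.sum_congr rfl fun σ _ => by
      rw [c.linearizeAt_lagEuler_eq_adjoint lam Ξ γ σ hξ]
  have h2 : ∀ (Ξ : VerticalField n m π), ∀ ξ ∈ c.regionCoord γ, c.jacobi lam Ξ (c.jet γ ξ) =
      ∑ ρ, (∑ σ, ∑ α ∈ multiIdx n (2 * r + 1),
        totalDs α (c.comp Ξ σ) (c.jet γ ξ) * jetPartialY σ α (c.lagEuler lam ρ) (c.jet γ ξ)) •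
          contactVol (c.jet γ ξ) ρ := fun Ξ ξ hξ => by
    rw [hlin Ξ ξ hξ]
    exact Finset.sum_congr rfl fun ρ _ => by rw [c.linearizeAt_lagEuler lam Ξ γ ρ hξ]
  have h3 : ∀ (Ξ : VerticalField n m π), ∀ ξ ∈ c.regionCoord γ, c.jacobi lam Ξ (c.jet γ ξ) =
      c.nabla (2 * r + 1) (c.jacobiCoeff lam) Ξ (c.jet γ ξ) := fun Ξ ξ hξ => by
    rw [h2 Ξ ξ hξ]
    simp only [FiberedChart.nabla, FiberedChart.jacobiCoeff, mul_comm]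
  refine ⟨h1, h2, fun Ξ ξ hξ => ⟨h3 Ξ ξ hξ, ?_⟩, fun Ξ₁ Ξ₂ hc => ?_⟩
  · rw [← h3 Ξ ξ hξ, h1 Ξ ξ hξ]
    simp only [FiberedChart.nablaStar, FiberedChart.jacobiCoeff, mul_comm (c.comp Ξ _ _)]
  · obtain ⟨K, hK, hKV, htest⟩ := hc.exists_isTestOn
    have hsec := c.isSecOn γ
    have hpair : ∀ Ξ Ξ' : VerticalField n m π,
        ∫ ξ in c.regionCoord γ, density (c.contract Ξ' (c.jacobi lam Ξ) (c.jet γ ξ)) =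
          ∫ ξ in c.regionCoord γ, ∑ σ, c.compAlong γ Ξ' ξ σ *
            linearizeAt (c.localRep γ) (c.compAlong γ Ξ) (c.lagEuler lam σ) ξ := fun Ξ Ξ' =>
      MeasureTheory.setIntegral_congr_fun hsec.isOpen.measurableSet fun ξ hξ =>
        c.density_contract_eq Ξ' (hlin Ξ ξ hξ)
    rw [hpair, hpair]
    exact (hsec.integral_mul_linearizeAt_eulerExpr_comm hK hKV (c.isJetSmooth_lagDensity lam)
      htest (c.contDiffOn_compAlong γ Ξ₂)).symm
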